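/- Let $\mathbb B$ be a relational structure with at most countable domain $B$ and finite relational signature, and let $\mathscr G$ be a subgroup of $\mathrm{Aut}(\mathbb B)$ that is oligomorphic, i.e., for every $k$ the group $\mathscr G$ has only finitely many orbits on $B^k$. Let $\overline{\mathscr G}\subseteq B^B$ be the closure of $\mathscr G$ in the topology of pointwise convergence ($B$ discrete), and let $\mathrm{Pol}(\mathbb B)$ be the set of all homomorphisms $\mathbb B^n\to\mathbb B$ for $n\ge 1$. A minor condition is a set of formal identities $f(x_{\sigma(1)},\dots,x_{\sigma(n)})\approx g(x_{\tau(1)},\dots,x_{\tau(m)})$. It is satisfied in $\mathrm{Pol}(\mathbb B)$ modulo $\overline{\mathscr G}$ if its symbols can be interpreted by operations in $\mathrm{Pol}(\mathbb B)$ of the corresponding arities in such a way that for each identity $s\approx t$ of the condition there are $u,v\in\overline{\mathscr G}$ with $u\circ s=v\circ t$. Consider the following conditions: - Olšák: $f(x,x,y,y,y,x)\approx f(x,y,x,y,x,y)\approx f(y,x,x,x,y,y)$; - 6-ary Siggers: $s(x,y,x,z,y,z)\approx s(y,x,z,x,z,y)$; - 4-ary Siggers: $s(x,y,z,x)\approx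 s(y,z,x,z)$; - $\mathrm{WNU}(k)$: $f(x,y,\dots,y)\approx f(y,x,y,\dots,y)\approx\dots\approx f(y,\dots,y,x)$, with $f$ of arity $k$. Let $\mathbb H_r$ be the structure on an $r$-element set with the ternary relation of all non-constant triples, let $\mathbb K_r$ be the complete loopless graph on $r$ vertices, and let $\mathbb D$ be the digraph on $\{x,y,z\}$ with edges $(x,y),(y,z),(z,x),(x,z)$. For structures $\mathbb C,\mathbb E$ in a common signature, $\mathbb B$ pp-constructs $(\mathbb C,\mathbb E)$ if for some $d\ge 1$ there is a structure $\mathbb P$ in that signature with domain $B^d$, each of whose $r$-ary relations, viewed as a $dr$-ary relation on $B$, is defined in $\mathbb B$ by a primitive positive formula (one built from atomic formulas, including equalities, by conjunction and existential quantification), such that there exist homomorphisms $\mathbb C\to\mathbb P$ and $\mathbb P\to\mathbb E$. For $k\ge 1$, a non-trivial $k$-strategy from $\mathbb X$ to $\mathbb B$ is a non-empty set $H$ of partial homomorphisms from $\mathbb X$ to $\mathbb B$ that is closed under restrictions and such that for all $f\in H$ with $|\mathrm{dom}(f)|<k$ and all $a\in X$ some $g\in H$ with domain $\mathrm{dom}(f)\cup\{a\}$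 extends $f$. The structure $\mathbb B$ has bounded width if there is $k\ge 1$ such that every finite structure $\mathbb X$ in the signature of $\mathbb B$ that admits a non-trivial $k$-strategy to $\mathbb B$ admits a homomorphism to $\mathbb B$. Then the following hold. 1. If $\mathbb B$ does not pp-construct $(\mathbb H_2,\mathbb H_r)$ for any $r\ge 2$, then $\mathrm{Pol}(\mathbb B)$ satisfies the Olšák condition modulo $\overline{\mathscr G}$. 2. If $\mathbb B$ does not pp-construct $(\mathbb K_3,\mathbb K_r)$ for any $r\ge 3$, then $\mathrm{Pol}(\mathbb B)$ satisfies the 6-ary Siggers condition modulo $\overline{\mathscr G}$. 3. If $\mathbb B$ does not pp-construct $(\mathbb D,\mathbb K_r)$ for any $r\ge 3$, then $\mathrm{Pol}(\mathbb B)$ satisfies the 4-ary Siggers condition modulo $\overline{\mathscr G}$. 4. If $\mathbb B$ has bounded width, then $\mathrm{Pol}(\mathbb B)$ satisfies $\mathrm{WNU}(k)$ modulo $\overline{\mathscr G}$ for all $k\ge 3$. -/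

import Mathlib

open FirstOrder

universe u v w u' v' w'

namespace PCSP

/-! ### Primitive positive formulas -/

/-- Primitive positive formulas: built from atomic formulas (relation symbols and equality) using
only conjunction and existential quantification. -/
inductive IsPrimitivePositive {L : FirstOrder.Language.{u, v}} {α : Type w} :
    ∀ {n : ℕ}, L.BoundedFormula α n → Prop
  | atomic {n : ℕ} {φ : L.BoundedFormula α n} (h : φ.IsAtomic) : IsPrimitivePositive φ
  | conj {n : ℕ} {φ ψ : L.BoundedFormula α n} (hφ : IsPrimitivePositive φ)
      (hψ : IsPrimitivePositive ψ) : IsPrimitivePositive (φ ⊓ ψ)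
  | ex {n : ℕ} {φ : L.BoundedFormula α (n + 1)} (h : IsPrimitivePositive φ) :
      IsPrimitivePositive φ.ex

/-! ### pp-powers and pp-constructions -/

/-- The data defining a `d`-dimensional pp-power with relational signature `L'`: for every relation
symbol of arity `r` a pp-formula over `L` whose `r * d` free variables are indexed by
`Fin r × Fin d` (the variable `(i, j)` is the `j`-th coordinate of the `i`-th argument). -/
structure PPPowerData (L : FirstOrder.Language.{u, v}) (L' : FirstOrder.Language.{u', v'}) (d : ℕ) where
  formula : ∀ {r : ℕ}, L'.Relations r → L.Formula (Fin r × Fin d)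
  isPrimitivePositive : ∀ {r : ℕ} (R : L'.Relations r), IsPrimitivePositive (formula R)

/-- The structure on `A ^ d` whose relations are those defined in `A` by the pp-formulas. -/
@[reducible]
def PPPowerData.structureOn {L : FirstOrder.Language.{u, v}} {L' : FirstOrder.Language.{u', v'}} [L'.IsRelational]
    {d : ℕ} (P : PPPowerData L L' d) (A : Type w) [L.Structure A] :
    L'.Structure (Fin d → A) where
  RelMap R x := (P.formula R).Realize fun p => x p.1 p.2

/-- There exists a homomorphism between two structures that are given explicitly. -/
def HomExists {L : FirstOrder.Language.{u, v}} {A : Type w} {B : Type w'}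
    (SA : L.Structure A) (SB : L.Structure B) : Prop :=
  Nonempty (A →[L] B)

/-- The template `(A, B)` pp-constructs the template `(C, D)`: the latter is a homomorphic
relaxation of a pp-power of the former. -/
def TemplatePPConstructs (L : FirstOrder.Language.{u, v}) (A : Type w) (B : Type w)
    [L.Structure A] [L.Structure B]
    {L' : FirstOrder.Language.{u', v'}} [L'.IsRelational] {C D : Type w'}
    (SC : L'.Structure C) (SD : L'.Structure D) : Prop :=
  ∃ (d : ℕ) (_ : 1 ≤ d) (P : PPPowerData L L' d),
    HomExists SC (P.structureOn A) ∧ HomExists (P.structureOn B) SD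

/-- The structure `B` pp-constructs the template `(C, D)`, i.e., the template `(B, B)` does. -/
def PPConstructs (L : FirstOrder.Language.{u, v}) (B : Type w) [L.Structure B]
    {L' : FirstOrder.Language.{u', v'}} [L'.IsRelational] {C D : Type w'}
    (SC : L'.Structure C) (SD : L'.Structure D) : Prop :=
  TemplatePPConstructs L B B SC SD

/-! ### The structures `H_r`, `K_r` and `D` -/

/-- A single ternary relation symbol. -/
inductive TernaryRel : ℕ → Type
  | rel : TernaryRel 3

/-- The relational language with a single ternary symbol. -/
def ternaryLanguage : FirstOrder.Language.{0, 0} := ⟨fun _ => Empty, TernaryRel⟩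

instance : ternaryLanguage.IsRelational := fun _ => (inferInstance : IsEmpty Empty)

/-- `H_r`: the domain has `r` elements and the relation holds of all non-constant triples. -/
@[reducible]
def structH (r : ℕ) : ternaryLanguage.Structure (Fin r) where
  funMap := fun f => Empty.elim f
  RelMap | .rel => fun x => ¬ (x 0 = x 1 ∧ x 1 = x 2)

/-- `K_r`: the complete (loopless) graph on `r` elements. -/
@[reducible]
def structK (r : ℕ) : FirstOrder.Language.graph.Structure (Fin r) :=
  (⊤ : SimpleGraph (Fin r)).structure

/-- `D`: the digraph on three vertices `x = 0`, `y = 1`, `z = 2` with edges `(x, y)`, `(y, z)`,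
`(z, x)`, `(x, z)`. -/
@[reducible]
def structD : FirstOrder.Language.graph.Structure (Fin 3) where
  funMap := fun f => Empty.elim f
  RelMap | .adj => fun x =>
    (x 0, x 1) ∈ ({(0, 1), (1, 2), (2, 0), (0, 2)} : Set (Fin 3 × Fin 3))

/-! ### Polymorphisms -/

/-- The power `A ^ n` of a relational structure; relations are interpreted componentwise. -/
@[reducible]
def powerStructure (L : FirstOrder.Language.{u, v}) [L.IsRelational] (A : Type w) [L.Structure A] (n : ℕ) :
    L.Structure (Fin n → A) where
  RelMap R x := ∀ i : Fin n, FirstOrder.Language.Structure.RelMap R fun j => x j i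

/-- The `n`-ary polymorphisms of the structure `B`: the homomorphisms `B ^ n → B`. -/
def Pol (L : FirstOrder.Language.{u, v}) [L.IsRelational] (B : Type w) [L.Structure B] (n : ℕ) :
    Set ((Fin n → B) → B) :=
  letI := powerStructure L B n
  {f | ∃ h : (Fin n → B) →[L] B, ⇑h = f}

/-! ### Automorphisms, oligomorphic groups, closures -/

/-- The automorphism group of `B`, as a group of permutations of the domain. -/
def autGroup (L : FirstOrder.Language.{u, v}) [L.IsRelational] (B : Type w) [L.Structure B] :
    Subgroup (Equiv.Perm B) where
  carrier := {g | ∀ {r : ℕ} (R : L.Relations r) (x : Fin r → B),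
    FirstOrder.Language.Structure.RelMap R (fun i => g (x i)) ↔ FirstOrder.Language.Structure.RelMap R x}
  one_mem' := fun _ _ => Iff.rfl
  mul_mem' := fun ha hb _ R x => (ha R fun i => _).trans (hb R x)
  inv_mem' := by
    intro g hg r R x
    rw [← hg R]
    simp

/-- A permutation group on `B` is oligomorphic if it has finitely many orbits on `k`-tuples, for
every `k`. -/
def IsOligomorphic {B : Type w} (G : Subgroup (Equiv.Perm B)) : Prop :=
  ∀ k : ℕ, Finite (MulAction.orbitRel.Quotient G (Fin k → B))

/-- The closure of a permutation group in the set of all unary functions on `B`, with respect to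
pointwise convergence (the product topology, where `B` is discrete). -/
def groupClosure {B : Type w} (G : Subgroup (Equiv.Perm B)) : Set (B → B) :=
  letI : TopologicalSpace B := ⊥
  closure {h : B → B | ∃ g ∈ G, ⇑g = h}

/-! ### Minor conditions -/

/-- A minor identity `f^σ ≈ g^τ` over a set `F` of operation symbols with arities `ar`. -/
structure MinorIdentity (F : Type) (ar : F → ℕ) where
  lhs : F
  rhs : F
  vars : ℕ
  σ : Fin (ar lhs) → Fin vars
  τ : Fin (ar rhs) → Fin vars

/-- `Pol(B)` satisfies the minor condition `S` modulo `U`: the symbols can be interpreted by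
polymorphisms `ξ f` such that for every identity `f^σ ≈ g^τ` in `S` there are `p, q ∈ U` with
`p ∘ (ξ f)^σ = q ∘ (ξ g)^τ`, where `h^σ (a) = h (a ∘ σ)`. -/
def SatisfiesModulo (L : FirstOrder.Language.{u, v}) [L.IsRelational] (B : Type w) [L.Structure B]
    (U : Set (B → B)) {F : Type} {ar : F → ℕ} (S : Set (MinorIdentity F ar)) : Prop :=
  ∃ ξ : (f : F) → (Fin (ar f) → B) → B,
    (∀ f, ξ f ∈ Pol L B (ar f)) ∧
    ∀ e ∈ S, ∃ p ∈ U, ∃ q ∈ U, ∀ a : Fin e.vars → B,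
      p (ξ e.lhs (a ∘ e.σ)) = q (ξ e.rhs (a ∘ e.τ))

/-- The minor condition, on a single `n`-ary symbol `f`, stating that the terms
`f (x_{t 1}, …, x_{t n})` for `t ∈ T` are all equal. -/
def allEqual {n m : ℕ} (T : Set (Fin n → Fin m)) :
    Set (MinorIdentity Unit fun _ => n) :=
  {e | ∃ s ∈ T, ∃ t ∈ T, e = ⟨(), (), m, s, t⟩}

/-- `f(x,x,y,y,y,x) ≈ f(x,y,x,y,x,y) ≈ f(y,x,x,x,y,y)`, with `x = 0`, `y = 1`. -/
def olsak : Set (MinorIdentity Unit fun _ => 6) :=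
  allEqual (m := 2) {![0, 0, 1, 1, 1, 0], ![0, 1, 0, 1, 0, 1], ![1, 0, 0, 0, 1, 1]}

/-- `s(x,y,x,z,y,z) ≈ s(y,x,z,x,z,y)`, with `x = 0`, `y = 1`, `z = 2`. -/
def siggers6 : Set (MinorIdentity Unit fun _ => 6) :=
  allEqual (m := 3) {![0, 1, 0, 2, 1, 2], ![1, 0, 2, 0, 2, 1]}

/-- `s(x,y,z,x) ≈ s(y,z,x,z)`, with `x = 0`, `y = 1`, `z = 2`. -/
def siggers4 : Set (MinorIdentity Unit fun _ => 4) :=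
  allEqual (m := 3) {![0, 1, 2, 0], ![1, 2, 0, 2]}

/-- `f(x,y,…,y) ≈ f(y,x,y,…,y) ≈ … ≈ f(y,…,y,x)`, where `f` is `k`-ary and `x = 0`, `y = 1`. -/
def wnu (k : ℕ) : Set (MinorIdentity Unit fun _ => k) :=
  allEqual (m := 2) (Set.range fun i j : Fin k => if j = i then 0 else 1)

/-! ### Local consistency and bounded width -/

/-- A partial homomorphism from `X` to `A`: a partial map that is a homomorphism on the substructure
of `X` induced by its domain. -/
def IsPartialHom (L : FirstOrder.Language.{u, v}) {X : Type w} {A : Type w'} [L.Structure X] [L.Structure A]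
    (f : X →. A) : Prop :=
  ∀ {r : ℕ} (R : L.Relations r) (x : Fin r → X) (hx : ∀ i, x i ∈ f.Dom),
    FirstOrder.Language.Structure.RelMap R x → FirstOrder.Language.Structure.RelMap R fun i => f.fn (x i) (hx i)

/-- `H` is a non-trivial `k`-strategy from `X` to `A`. -/
structure IsStrategy (L : FirstOrder.Language.{u, v}) {X : Type w} {A : Type w'} [L.Structure X]
    [L.Structure A] (k : ℕ) (H : Set (X →. A)) : Prop where
  nonempty : H.Nonempty
  partialHom : ∀ f ∈ H, IsPartialHom L f
  restrict : ∀ f ∈ H, ∀ (K : Set X) (hK : K ⊆ f.Dom), f.restrict hK ∈ H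
  extend : ∀ f ∈ H, f.Dom.encard < k → ∀ a : X,
    ∃ g ∈ H, g.Dom = f.Dom ∪ {a} ∧ ∀ x y, y ∈ f x → y ∈ g x

/-- The template `(A, B)` has width `k`: every (finite) instance `X` admitting a non-trivial
`k`-strategy to `A` admits a homomorphism to `B`. -/
def HasWidth (L : FirstOrder.Language.{u, v}) (A B : Type w) [L.Structure A] [L.Structure B] (k : ℕ) : Prop :=
  ∀ (X : Type) [Finite X] [L.Structure X],
    (∃ H : Set (X →. A), IsStrategy L k H) → Nonempty (X →[L] B)

/-- The structure `B` has bounded width: the template `(B, B)` has width `k` for some `k ≥ 1`. -/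
def BoundedWidth (L : FirstOrder.Language.{u, v}) (B : Type w) [L.Structure B] : Prop :=
  ∃ k : ℕ, 1 ≤ k ∧ HasWidth L B B k

end PCSP

namespace PCSP

/-! Since the group is oligomorphic, a compactness argument turns failure of the identities f^{σ j}
≈ f^{σ j'} modulo the closure into a finite obstruction (`exists_finite_obstruction`). It consists
of evaluations a_1, …, a_d and finitely many arguments such that no partial polymorphism η on these
arguments sends all rows (a_i ∘ σ j)_i to d-tuples in one G-orbit.

Items 1–3: over a finite signature the possible row values form a pp-definable relation on d-tuples.
The projections put the columns of the identities into it, and colouring d-tuples by their finitely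
many orbits is never constant on its members. The columns are exactly the edges of H_2, K_3 or D, so
the obstruction gives homomorphisms into a pp-power and from it to H_r or K_r.

Item 4: take a k-uniform hypergraph that is locally a forest but not colourable with as many colours
as there are orbits (`exists_sparse_not_colorable`), and put a copy of the obstruction on each edge.
A homomorphism to B colours vertices by orbits, and a monochromatic edge contradicts the
obstruction. However, the projections turn one-in-k solutions on the hypergraph into maps to B, and
sparsity makes these constraints locally solvable (`exists_isReducible`). Hence non-trivial
strategies exist, against bounded width. -/

/-! ### Compactness for oligomorphic groups and finite obstructions -/

open Filter in
/-- Compactness for oligomorphic groups: if a `G`-invariant property of restrictions to finite sets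
can be satisfied on every finite set, then it can be satisfied on all finite sets at once. -/
theorem exists_forall_good {B : Type w} {Z : Type*} [Countable Z] {G : Subgroup (Equiv.Perm B)}
    (hGo : IsOligomorphic G) (Good : Finset Z → (Z → B) → Prop)
    (mono : ∀ W W' f, W ⊆ W' → Good W' f → Good W f)
    (congr : ∀ W f f', (∀ z ∈ W, f z = f' z) → Good W f → Good W f')
    (inv : ∀ W f, ∀ g ∈ G, Good W f → Good W fun z => g (f z))
    (exist : ∀ W, ∃ f, Good W f) : ∃ f, ∀ W, Good W f := by
  classical
  rcases isEmpty_or_nonempty Z with hZ | hZ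
  · obtain ⟨f, hf⟩ := exist ∅
    exact ⟨f, fun W => by rwa [Finset.eq_empty_of_isEmpty W]⟩
  obtain ⟨enum, henum⟩ := exists_surjective_nat Z
  let W : ℕ → Finset Z := fun i => (Finset.range i).image enum
  have hW : Monotone W := fun i j hij =>
    Finset.image_subset_image (Finset.range_mono hij)
  choose F hF using exist
  let f : ℕ → Z → B := fun i => F (W i)
  -- A nonprincipal ultrafilter replaces passing to subsequences: of the finitely many orbits of
  -- tuples indexed by a finite set, it selects one.
  let 𝒰 : Ultrafilter ℕ := hyperfilter ℕ
  have h𝒰 : ∀ n : ℕ, ∀ᶠ i in (𝒰 : Filter ℕ), n ≤ i := fun n =>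
    Nat.hyperfilter_le_atTop (eventually_ge_atTop n)
  have lim : ∀ V : Finset Z, ∃ ψ : Z → B, ∀ᶠ i in (𝒰 : Filter ℕ), ∃ g ∈ G, ∀ z ∈ V,
      g (f i z) = ψ z := by
    intro V
    let e := V.equivFin.symm
    have := hGo V.card
    let o : ℕ → MulAction.orbitRel.Quotient G (Fin V.card → B) := fun i =>
      Quotient.mk'' fun j => f i (e j)
    obtain ⟨c, hc⟩ := (𝒰.map o).eq_pure_of_finite
    have hc' : ∀ᶠ i in (𝒰 : Filter ℕ), o i = c := by
      have : {c} ∈ 𝒰.map o := by rw [hc]; exact Set.mem_singleton c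
      exact this
    obtain ⟨i₀, hi₀⟩ := hc'.exists
    refine ⟨f i₀, hc'.mono fun i hi => ?_⟩
    have h := hi₀.trans hi.symm
    obtain ⟨g, hg⟩ := Quotient.exact' h
    refine ⟨g, g.2, fun z hz => ?_⟩
    have := congrFun hg (V.equivFin ⟨z, hz⟩)
    simpa [e, Subgroup.smul_def] using this
  let Φ := fun n (φ : Z → B) => ∀ᶠ i in (𝒰 : Filter ℕ), ∃ g ∈ G, ∀ z ∈ W n, g (f i z) = φ z
  have step : ∀ n φ, Φ n φ → ∃ φ', Φ (n + 1) φ' ∧ ∀ z ∈ W n, φ' z = φ z := by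
    intro n φ hφ
    obtain ⟨ψ, hψ⟩ := lim (W (n + 1))
    obtain ⟨i, ⟨g, hg, hgφ⟩, ⟨g', hg', hgψ⟩⟩ := (hφ.and hψ).exists
    -- The limit `ψ` is only determined up to translation by `G`. At a common index `i` both `φ` and
    -- `ψ` are translates of `f i` on `W n`, which gives the translation aligning them.
    refine ⟨fun z => g (g'⁻¹ (ψ z)), ?_, fun z hz => ?_⟩
    · refine hψ.mono fun i => ?_
      rintro ⟨g₁, hg₁, h₁⟩
      exact ⟨g * g'⁻¹ * g₁, G.mul_mem (G.mul_mem hg (G.inv_mem hg')) hg₁, fun z hz => by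
        simp [← h₁ z hz]⟩
    · simp [← hgψ z (hW n.le_succ hz), hgφ z hz]
  obtain ⟨φ₀, hφ₀⟩ := lim (W 0)
  choose next hnext hext using step
  let φ : (n : ℕ) → {φ // Φ n φ} := fun n =>
    Nat.rec ⟨φ₀, hφ₀⟩ (fun n φ => ⟨next n φ.1 φ.2, hnext n φ.1 φ.2⟩) n
  have hφ : ∀ n m, n ≤ m → ∀ z ∈ W n, (φ m).1 z = (φ n).1 z := by
    intro n m hnm z hz
    induction m, hnm using Nat.le_induction with
    | base => rfl
    | succ m hm ih => exact (hext m (φ m).1 (φ m).2 z (hW hm hz)).trans ih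
  choose idx hidx using henum
  have hmem : ∀ z, z ∈ W (idx z + 1) := fun z =>
    Finset.mem_image.2 ⟨idx z, by simp, hidx z⟩
  refine ⟨fun z => (φ (idx z + 1)).1 z, fun V => ?_⟩
  let N := V.sup fun z => idx z + 1
  have hVN : V ⊆ W N := fun z hz =>
    hW (Finset.le_sup (f := fun z => idx z + 1) hz) (hmem z)
  obtain ⟨i, ⟨g, hg, hgφ⟩, hi⟩ := ((φ N).2.and (h𝒰 N)).exists
  refine congr _ _ _ (fun z hz => ?_)
    (mono _ _ _ (hVN.trans (hW hi)) (inv _ _ g hg (hF (W i))))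
  change g (f i z) = _
  rw [hgφ z (hVN hz)]
  exact hφ _ _ (Finset.le_sup (f := fun z => idx z + 1) hz) z (hmem z)

theorem mem_groupClosure {B : Type w} {G : Subgroup (Equiv.Perm B)} {p : B → B}
    (h : ∀ V : Finset B, ∃ g ∈ G, ∀ x ∈ V, g x = p x) : p ∈ groupClosure G := by
  let : TopologicalSpace B := ⊥
  have : DiscreteTopology B := ⟨rfl⟩
  change p ∈ closure _
  rw [mem_closure_iff]
  intro O hO hp
  obtain ⟨V, t, ht, hsub⟩ := isOpen_pi_iff.1 hO p hp
  obtain ⟨g, hg, hgV⟩ := h V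
  refine ⟨⇑g, hsub fun x hx => ?_, g, hg, rfl⟩
  rw [hgV x hx]
  exact (ht x hx).2

/-- Two functions whose restrictions to finite sets lie in the same `G`-orbit become equal after
composition with elements of the closure of `G`. -/
theorem exists_groupClosure_comp_eq {B : Type w} [Countable B] {A : Type*}
    {G : Subgroup (Equiv.Perm B)} (hGo : IsOligomorphic G) (f f' : A → B)
    (h : ∀ V : Finset A, ∃ g ∈ G, ∀ a ∈ V, g (f a) = f' a) :
    ∃ p ∈ groupClosure G, ∃ q ∈ groupClosure G, ∀ a, p (f a) = q (f' a) := by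
  classical
  -- The pair (p, q) is encoded as a single function on `B ⊕ B`.
  obtain ⟨z, hz⟩ := exists_forall_good (Z := B ⊕ B) hGo
    (fun W z => ∃ g ∈ G, ∃ g' ∈ G, (∀ x, .inl x ∈ W → z (.inl x) = g x) ∧
      (∀ x, .inr x ∈ W → z (.inr x) = g' x) ∧
      ∀ a, .inl (f a) ∈ W → .inr (f' a) ∈ W → z (.inl (f a)) = z (.inr (f' a)))
    (by
      rintro W W' z hW ⟨g, hg, g', hg', h₁, h₂, h₃⟩
      exact ⟨g, hg, g', hg', fun x hx => h₁ x (hW hx), fun x hx => h₂ x (hW hx),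
        fun a ha ha' => h₃ a (hW ha) (hW ha')⟩)
    (by
      rintro W z z' hzz ⟨g, hg, g', hg', h₁, h₂, h₃⟩
      refine ⟨g, hg, g', hg', fun x hx => ?_, fun x hx => ?_, fun a ha ha' => ?_⟩
      · rw [← hzz _ hx, h₁ x hx]
      · rw [← hzz _ hx, h₂ x hx]
      · rw [← hzz _ ha, ← hzz _ ha', h₃ a ha ha'])
    (by
      rintro W z k hk ⟨g, hg, g', hg', h₁, h₂, h₃⟩
      refine ⟨k * g, G.mul_mem hk hg, k * g', G.mul_mem hk hg', fun x hx => ?_, fun x hx => ?_,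
        fun a ha ha' => ?_⟩
      · simp [h₁ x hx]
      · simp [h₂ x hx]
      · simp [h₃ a ha ha'])
    (by
      intro W
      -- Although `A` may be infinite, only finitely many value pairs are visible in `W`, so one
      -- representative of each suffices.
      have hfin : {y : B × B | .inl y.1 ∈ W ∧ .inr y.2 ∈ W ∧ ∃ a, y = (f a, f' a)}.Finite := by
        refine Set.Finite.subset
          ((W.finite_toSet.preimage Sum.inl_injective.injOn).prod
            (W.finite_toSet.preimage Sum.inr_injective.injOn)) ?_
        rintro y ⟨h₁, h₂, -⟩
        exact ⟨h₁, h₂⟩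
      have : ∀ y : hfin.toFinset, ∃ a, y.1 = (f a, f' a) := fun y => by
        have := y.2
        rw [Set.Finite.mem_toFinset] at this
        exact this.2.2
      choose s hs using this
      obtain ⟨g, hg, hgs⟩ := h (Finset.univ.image s)
      refine ⟨Sum.elim g id, g, hg, 1, G.one_mem, fun _ _ => rfl, fun _ _ => rfl,
        fun a ha ha' => ?_⟩
      have hmem : (f a, f' a) ∈ hfin.toFinset := by
        rw [Set.Finite.mem_toFinset]; exact ⟨ha, ha', a, rfl⟩
      have h₁ := hs ⟨_, hmem⟩
      have h₂ := hgs _ (Finset.mem_image_of_mem s (Finset.mem_univ ⟨_, hmem⟩))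
      simp only [Prod.mk.injEq] at h₁
      rw [← h₁.1, ← h₁.2] at h₂
      exact h₂)
  refine ⟨fun x => z (.inl x), mem_groupClosure fun V => ?_, fun x => z (.inr x),
    mem_groupClosure fun V => ?_, fun a => ?_⟩
  · obtain ⟨g, hg, -, -, h₁, -, -⟩ := hz (V.map ⟨Sum.inl, Sum.inl_injective⟩)
    exact ⟨g, hg, fun x hx => (h₁ x (by simpa using hx)).symm⟩
  · obtain ⟨-, -, g, hg, -, h₂, -⟩ := hz (V.map ⟨Sum.inr, Sum.inr_injective⟩)
    exact ⟨g, hg, fun x hx => (h₂ x (by simpa using hx)).symm⟩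
  · obtain ⟨-, -, -, -, -, -, h₃⟩ := hz {.inl (f a), .inr (f' a)}
    exact h₃ a (by simp) (by simp)

open FirstOrder.Language in
/-- If the identities `f^{σ j} ≈ f^{σ j'}` are not satisfied modulo the closure of `G`, then this is
witnessed by finitely many evaluations `a i` and finitely many arguments `ω s` of `f`. -/
theorem exists_finite_obstruction {L : FirstOrder.Language.{u, v}} [L.IsRelational] {B : Type w}
    [Countable B] [L.Structure B] {G : Subgroup (Equiv.Perm B)} (hG : G ≤ autGroup L B)
    (hGo : IsOligomorphic G) {n m q : ℕ} [NeZero n] (σ : Fin q → Fin n → Fin m)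
    (hσ : ∀ j, Function.Surjective (σ j))
    (h : ¬ SatisfiesModulo L B (groupClosure G) (allEqual (Set.range σ))) :
    ∃ (d N : ℕ) (a : Fin d → Fin m → B) (ω : Fin N → Fin n → B) (idx : Fin q → Fin d → Fin N),
      Function.Injective a ∧ (∀ j i, ω (idx j i) = a i ∘ σ j) ∧
      ∀ η : Fin N → B,
        (∀ {r : ℕ} (R : L.Relations r) (x : Fin r → Fin N),
          (∀ i, Structure.RelMap R fun l => ω (x l) i) → Structure.RelMap R fun l => η (x l)) →
        ¬ ∀ j j', ∃ g ∈ G, ∀ i, g (η (idx j i)) = η (idx j' i) := by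
  classical
  by_contra! hcon
  refine h ?_
  obtain ⟨f, hf⟩ := exists_forall_good (Z := Fin n → B) hGo
    (fun W f =>
      (∀ (r : ℕ) (R : L.Relations r) (x : Fin r → Fin n → B), (∀ l, x l ∈ W) →
        (∀ i, Structure.RelMap R fun l => x l i) → Structure.RelMap R fun l => f (x l)) ∧
      ∀ j j', ∃ g ∈ G, ∀ a : Fin m → B, a ∘ σ j ∈ W → a ∘ σ j' ∈ W →
        g (f (a ∘ σ j)) = f (a ∘ σ j'))
    (by
      rintro W W' f hW ⟨h₁, h₂⟩
      refine ⟨fun r R x hx => h₁ r R x fun l => hW (hx l), fun j j' => ?_⟩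
      obtain ⟨g, hg, hga⟩ := h₂ j j'
      exact ⟨g, hg, fun a ha ha' => hga a (hW ha) (hW ha')⟩)
    (by
      rintro W f f' hff ⟨h₁, h₂⟩
      refine ⟨fun r R x hx hR => ?_, fun j j' => ?_⟩
      · simp_rw [← hff _ (hx _)]
        exact h₁ r R x hx hR
      · obtain ⟨g, hg, hga⟩ := h₂ j j'
        exact ⟨g, hg, fun a ha ha' => by rw [← hff _ ha, ← hff _ ha', hga a ha ha']⟩)
    (by
      rintro W f k hk ⟨h₁, h₂⟩
      refine ⟨fun r R x hx hR => (hG hk R _).2 (h₁ r R x hx hR), fun j j' => ?_⟩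
      obtain ⟨g, hg, hga⟩ := h₂ j j'
      -- Translating `f` by `k` conjugates the element that carries one row to the other.
      exact ⟨k * g * k⁻¹, G.mul_mem (G.mul_mem hk hg) (G.inv_mem hk), fun a ha ha' => by
        simp [hga a ha ha']⟩)
    (by
      intro W
      -- Surjectivity of `σ j` is what leaves only finitely many evaluations relevant to `W`; `W'`
      -- then adds all rows of those evaluations.
      have hinj : ∀ j, Function.Injective fun a : Fin m → B => a ∘ σ j := fun j a a' haa => by
        funext y
        obtain ⟨l, rfl⟩ := hσ j y
        exact congrFun haa l
      have hA : {a : Fin m → B | ∃ j, a ∘ σ j ∈ W}.Finite := by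
        rw [show {a : Fin m → B | ∃ j, a ∘ σ j ∈ W} = ⋃ j, (fun a => a ∘ σ j) ⁻¹' W by
          ext; simp]
        exact Set.finite_iUnion fun j => W.finite_toSet.preimage (hinj j).injOn
      let A := hA.toFinset
      let W' := W ∪ Finset.univ.biUnion fun j => A.image fun a => a ∘ σ j
      have hW' : ∀ j, ∀ a ∈ A, a ∘ σ j ∈ W' := fun j a ha =>
        Finset.mem_union_right _ (Finset.mem_biUnion.2 ⟨j, Finset.mem_univ _,
          Finset.mem_image_of_mem (fun a => a ∘ σ j) ha⟩)
      let eA := A.equivFin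
      let eW := W'.equivFin
      obtain ⟨η, hη, horb⟩ := hcon A.card W'.card (fun i => (eA.symm i).1)
        (fun s => (eW.symm s).1) (fun j i => eW ⟨_, hW' j _ (eA.symm i).2⟩)
        (Subtype.val_injective.comp eA.symm.injective) (fun j i => by simp)
      refine ⟨fun x => if hx : x ∈ W' then η (eW ⟨x, hx⟩) else x 0, fun r R x hx hR => ?_,
        fun j j' => ?_⟩
      · have hx' : ∀ l, x l ∈ W' := fun l => Finset.mem_union_left _ (hx l)
        simp only [hx', dif_pos]
        exact hη R (fun l => eW ⟨x l, hx' l⟩) fun i => by simpa using hR i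
      · obtain ⟨g, hg, hga⟩ := horb j j'
        refine ⟨g, hg, fun a ha ha' => ?_⟩
        have haA : a ∈ A := by rw [Set.Finite.mem_toFinset]; exact ⟨j, ha⟩
        have := hga (eA ⟨a, haA⟩)
        simp only [Equiv.symm_apply_apply] at this
        beta_reduce
        rw [dif_pos (hW' j a haA), dif_pos (hW' j' a haA)]
        exact this)
  refine ⟨fun _ => f, fun _ => ?_, ?_⟩
  · let := powerStructure L B n
    refine ⟨⟨f, fun F => isEmptyElim F, fun {r} R x hR => ?_⟩, rfl⟩
    exact (hf (Finset.univ.image x)).1 r R x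
      (fun l => Finset.mem_image_of_mem _ (Finset.mem_univ _)) hR
  · rintro _ ⟨_, ⟨j, rfl⟩, _, ⟨j', rfl⟩, rfl⟩
    refine exists_groupClosure_comp_eq hGo (fun a : Fin m → B => f (a ∘ σ j))
      (fun a => f (a ∘ σ j')) fun V => ?_
    obtain ⟨g, hg, hga⟩ :=
      (hf (V.image (fun a => a ∘ σ j) ∪ V.image (fun a => a ∘ σ j'))).2 j j'
    exact ⟨g, hg, fun a ha => hga a
      (Finset.mem_union_left _ (Finset.mem_image_of_mem (fun a => a ∘ σ j) ha))
      (Finset.mem_union_right _ (Finset.mem_image_of_mem (fun a => a ∘ σ j') ha))⟩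

/-! ### Primitive positive definitions and orbit colourings -/

open FirstOrder.Language in
theorem exists_isPrimitivePositive_conj {L : FirstOrder.Language.{u, v}} {α : Type w} [Nonempty α]
    {N : ℕ} {ι : Type*} [Finite ι] (φ : ι → L.BoundedFormula α N)
    (hφ : ∀ i, IsPrimitivePositive (φ i)) :
    ∃ ψ : L.BoundedFormula α N, IsPrimitivePositive ψ ∧
      ∀ {B : Type w'} [L.Structure B] (x : α → B) (y : Fin N → B),
        ψ.Realize x y ↔ ∀ i, (φ i).Realize x y := by
  obtain ⟨l, hl⟩ : ∃ l : List ι, ∀ i, i ∈ l := by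
    have := Fintype.ofFinite ι
    exact ⟨Finset.univ.toList, by simp⟩
  suffices H : ∃ ψ : L.BoundedFormula α N, IsPrimitivePositive ψ ∧
      ∀ {B : Type w'} [L.Structure B] (x : α → B) (y : Fin N → B),
        ψ.Realize x y ↔ ∀ i ∈ l, (φ i).Realize x y by
    obtain ⟨ψ, hψ, h⟩ := H
    exact ⟨ψ, hψ, fun x y => by simp [h, hl]⟩
  clear hl
  induction l with
  | nil =>
    -- The formula ⊤ is not primitive positive here, so the empty conjunction is written as t = t,
    -- which needs a variable.
    let t : L.Term (α ⊕ Fin N) := .var (.inl (Classical.arbitrary α))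
    exact ⟨t.bdEqual t, .atomic (.equal _ _), fun x y => by simp⟩
  | cons i l ih =>
    obtain ⟨ψ, hψ, h⟩ := ih
    exact ⟨φ i ⊓ ψ, .conj (hφ i) hψ, fun x y => by simp [h]⟩

theorem IsPrimitivePositive.exs {L : FirstOrder.Language.{u, v}} {α : Type w} :
    ∀ {N : ℕ} {φ : L.BoundedFormula α N}, IsPrimitivePositive φ → IsPrimitivePositive φ.exs
  | 0, _, h => h
  | _ + 1, φ, h => IsPrimitivePositive.exs (φ := φ.ex) (.ex h)

open FirstOrder.Language in
/-- The relation consisting of the values of partial polymorphisms is pp-definable. -/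
theorem exists_isPrimitivePositive_diagram {L : FirstOrder.Language.{u, v}} [Finite L.Symbols]
    {B : Type w} [L.Structure B] {n N : ℕ} (ω : Fin N → Fin n → B) {α : Type} [Finite α]
    [Nonempty α] (idx : α → Fin N) :
    ∃ φ : L.Formula α, IsPrimitivePositive φ ∧ ∀ x : α → B, φ.Realize x ↔
      ∃ η : Fin N → B,
        (∀ {r : ℕ} (R : L.Relations r) (y : Fin r → Fin N),
          (∀ i, Structure.RelMap R fun l => ω (y l) i) → Structure.RelMap R fun l => η (y l)) ∧
        ∀ p, η (idx p) = x p := by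
  have hfin : Finite (Σ l, L.Relations l) :=
    Finite.of_injective (β := L.Symbols) Sum.inr Sum.inr_injective
  -- The conjuncts are all relational facts that hold among the `ω s` in the power, together with
  -- the equations linking quantified to free variables. Finiteness of the signature makes this a
  -- finite set.
  let ι := {z : Σ R : (Σ l, L.Relations l), (Fin R.1 → Fin N) //
    ∀ i, Structure.RelMap z.1.2 fun l => ω (z.2 l) i} ⊕ α
  let φ : ι → L.BoundedFormula α N := Sum.elim
    (fun z => z.1.1.2.boundedFormula fun l => .var (.inr (z.1.2 l)))
    (fun p => Term.bdEqual (.var (.inr (idx p))) (.var (.inl p)))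
  obtain ⟨ψ, hψ, h⟩ := exists_isPrimitivePositive_conj.{u, v, 0, w} φ (by
    rintro (z | p)
    · exact .atomic (.rel _ _)
    · exact .atomic (.equal _ _))
  refine ⟨ψ.exs, hψ.exs, fun x => ?_⟩
  rw [BoundedFormula.realize_exs]
  refine exists_congr fun η => ?_
  rw [h, Sum.forall]
  refine and_congr ⟨fun H r R y hR => ?_, fun H z => ?_⟩ (forall_congr' fun p => ?_)
  · simpa [φ] using H ⟨⟨⟨r, R⟩, y⟩, hR⟩
  · simpa [φ] using H z.1.1.2 z.1.2 z.2
  · simp [φ]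

/-- The tuples can be colored with finitely many colors in such a way that two tuples get the same
color only if they lie in the same orbit. -/
theorem exists_orbit_coloring {B : Type w} {G : Subgroup (Equiv.Perm B)} (hGo : IsOligomorphic G)
    (d s : ℕ) : ∃ r, s ≤ r ∧ ∃ c : (Fin d → B) → Fin r, ∀ t t', c t = c t' →
      ∃ g ∈ G, ∀ i, g (t i) = t' i := by
  have := hGo d
  obtain ⟨r₀, ⟨e⟩⟩ := Finite.exists_equiv_fin (MulAction.orbitRel.Quotient G (Fin d → B))
  refine ⟨max s r₀, le_max_left _ _,
    fun t => Fin.castLE (le_max_right _ _) (e (Quotient.mk'' t)), fun t t' h => ?_⟩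
  have h' := e.injective (Fin.castLE_injective _ h)
  obtain ⟨g, hg⟩ := Quotient.exact' h'.symm
  exact ⟨g, g.2, fun i => congrFun hg i⟩

open FirstOrder.Language in
/-- A failing minor condition given by the edges of a structure on `Fin m` yields a `pp`-formula
satisfied by all edges, together with a coloring of tuples that is non-constant on all tuples
satisfying the formula. -/
theorem exists_pp_formula_of_not_satisfiesModulo {L : FirstOrder.Language.{u, v}}
    [L.IsRelational] [Finite L.Symbols] {B : Type w}
    [Countable B] [L.Structure B] {G : Subgroup (Equiv.Perm B)} (hG : G ≤ autGroup L B)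
    (hGo : IsOligomorphic G) {n m q : ℕ} [NeZero n] [NeZero q] (σ : Fin q → Fin n → Fin m)
    (hσ : ∀ j, Function.Surjective (σ j)) (s : ℕ)
    (h : ¬ SatisfiesModulo L B (groupClosure G) (allEqual (Set.range σ))) :
    ∃ d, 1 ≤ d ∧ ∃ (φ : L.Formula (Fin q × Fin d)) (a : Fin m → Fin d → B) (r : ℕ)
      (c : (Fin d → B) → Fin r), IsPrimitivePositive φ ∧ s ≤ r ∧
      (∀ l, φ.Realize fun p => a (σ p.1 l) p.2) ∧
      ∀ x : Fin q → Fin d → B, (φ.Realize fun p => x p.1 p.2) → ¬ ∀ j j', c (x j) = c (x j') := by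
  obtain ⟨d, N, a, ω, idx, -, hidx, hη⟩ := exists_finite_obstruction hG hGo σ hσ h
  have hd : 1 ≤ d := by
    by_contra! hd
    obtain rfl : d = 0 := by omega
    -- With no evaluations the orbit condition is void, and a projection defeats the obstruction.
    exact hη (fun s => ω s 0) (fun R x hR => hR 0) fun j j' => ⟨1, G.one_mem, fun i => i.elim0⟩
  have : NeZero d := ⟨by omega⟩
  obtain ⟨φ, hφ, H⟩ := exists_isPrimitivePositive_diagram (L := L) ω
    fun p : Fin q × Fin d => idx p.1 p.2
  obtain ⟨r, hr, c, hc⟩ := exists_orbit_coloring hGo d s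
  refine ⟨d, hd, φ, fun y i => a i y, r, c, hφ, hr, fun l => ?_, fun x hx hcx => ?_⟩
  -- The `l`-th projection is a partial polymorphism, and its row values are the `l`-th column.
  · refine (H _).2 ⟨fun s => ω s l, fun R y hR => hR l, fun p => ?_⟩
    exact congrFun (hidx p.1 p.2) l
  · obtain ⟨η, h₁, h₂⟩ := (H _).1 hx
    refine hη η h₁ fun j j' => ?_
    obtain ⟨g, hg, hgx⟩ := hc _ _ (hcx j j')
    refine ⟨g, hg, fun i => ?_⟩
    rw [h₂ (j, i), h₂ (j', i)]
    exact hgx i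

/-! ### The Olšák and Siggers conditions -/

/-- The six columns of the 3 × 6 matrix of the identities are precisely the non-constant triples
over {0, 1}, that is, the edges of H_2. -/
theorem satisfiesModulo_olsak {L : FirstOrder.Language.{u, v}} [L.IsRelational]
    [Finite L.Symbols] {B : Type w} [Countable B] [L.Structure B]
    {G : Subgroup (Equiv.Perm B)} (hG : G ≤ autGroup L B) (hGo : IsOligomorphic G)
    (h : ∀ r : ℕ, 2 ≤ r → ¬ PPConstructs L B (structH 2) (structH r)) :
    SatisfiesModulo L B (groupClosure G) olsak := by
  by_contra hcon
  let σ : Fin 3 → Fin 6 → Fin 2 :=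
    ![![0, 0, 1, 1, 1, 0], ![0, 1, 0, 1, 0, 1], ![1, 0, 0, 0, 1, 1] ]
  have hσ : olsak = allEqual (Set.range σ) := by
    rw [olsak]; congr 1; simp only [σ, Matrix.range_cons, Matrix.range_empty, Set.insert_eq, Set.union_empty]
  rw [hσ] at hcon
  obtain ⟨d, hd, φ, a, r, c, hφ, hr, ha, hc⟩ := exists_pp_formula_of_not_satisfiesModulo hG hGo σ
    (by decide) 2 hcon
  have hedge : ∀ x : Fin 3 → Fin 2, ¬ (x 0 = x 1 ∧ x 1 = x 2) → ∃ l, ∀ j, x j = σ j l := by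
    decide
  let P : PPPowerData L ternaryLanguage d :=
    { formula := fun R => match R with | .rel => φ
      isPrimitivePositive := fun R => match R with | .rel => hφ }
  refine h r hr ⟨d, hd, P, ?_, ?_⟩
  · let := structH 2
    let := P.structureOn B
    refine ⟨⟨a, fun F => isEmptyElim F, fun R x hx => ?_⟩⟩
    cases R
    obtain ⟨l, hl⟩ := hedge x hx
    have := ha l
    simp only [← hl] at this
    exact this
  · let := structH r
    let := P.structureOn B
    refine ⟨⟨c, fun F => isEmptyElim F, fun R x hx => ?_⟩⟩
    cases R
    rintro ⟨h₁, h₂⟩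
    refine hc x hx ?_
    simp only [Function.comp] at h₁ h₂
    intro j j'
    fin_cases j <;> fin_cases j' <;> simp [h₁, h₂]

/-- With two rows the columns are pairs. As every edge of `S` occurs as a column, `a` is a
homomorphism into the pp-power; for pairs, a non-constant colouring is a proper one. For 6-ary and
4-ary Siggers the columns list the edges of K_3 and of D. -/
theorem satisfiesModulo_of_graph {L : FirstOrder.Language.{u, v}} [L.IsRelational]
    [Finite L.Symbols] {B : Type w} [Countable B] [L.Structure B]
    {G : Subgroup (Equiv.Perm B)} (hG : G ≤ autGroup L B) (hGo : IsOligomorphic G)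
    {n m : ℕ} [NeZero n] (σ : Fin 2 → Fin n → Fin m) (hσ : ∀ j, Function.Surjective (σ j))
    (S : Language.graph.Structure (Fin m))
    (hS : ∀ x : Fin 2 → Fin m, S.RelMap Language.adj x → ∃ l, ∀ j, x j = σ j l)
    (h : ∀ r : ℕ, 3 ≤ r → ¬ PPConstructs L B S (structK r)) :
    SatisfiesModulo L B (groupClosure G) (allEqual (Set.range σ)) := by
  by_contra hcon
  obtain ⟨d, hd, φ, a, r, c, hφ, hr, ha, hc⟩ := exists_pp_formula_of_not_satisfiesModulo hG hGo σ
    hσ 3 hcon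
  let P : PPPowerData L Language.graph d :=
    { formula := fun R => match R with | .adj => φ
      isPrimitivePositive := fun R => match R with | .adj => hφ }
  refine h r hr ⟨d, hd, P, ?_, ?_⟩
  · let := P.structureOn B
    refine ⟨⟨a, fun F => isEmptyElim F, fun R x hx => ?_⟩⟩
    cases R
    obtain ⟨l, hl⟩ := hS x hx
    have := ha l
    simp only [← hl] at this
    exact this
  · let := structK r
    let := P.structureOn B
    refine ⟨⟨c, fun F => isEmptyElim F, fun R x hx => ?_⟩⟩
    cases R
    intro h₁
    refine hc x hx ?_
    simp only [Function.comp] at h₁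
    intro j j'
    fin_cases j <;> fin_cases j' <;> simp [h₁]

theorem satisfiesModulo_siggers6 {L : FirstOrder.Language.{u, v}} [L.IsRelational]
    [Finite L.Symbols] {B : Type w} [Countable B] [L.Structure B]
    {G : Subgroup (Equiv.Perm B)} (hG : G ≤ autGroup L B) (hGo : IsOligomorphic G)
    (h : ∀ r : ℕ, 3 ≤ r → ¬ PPConstructs L B (structK 3) (structK r)) :
    SatisfiesModulo L B (groupClosure G) siggers6 := by
  have := satisfiesModulo_of_graph hG hGo ![![0, 1, 0, 2, 1, 2], ![1, 0, 2, 0, 2, 1] ]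
    (by decide) (structK 3) (fun x hx => by
      change x 0 ≠ x 1 at hx
      revert x
      decide) h
  rw [siggers6]
  convert this using 2
  simp only [Matrix.range_cons, Matrix.range_empty, Set.insert_eq, Set.union_empty]

theorem satisfiesModulo_siggers4 {L : FirstOrder.Language.{u, v}} [L.IsRelational]
    [Finite L.Symbols] {B : Type w} [Countable B] [L.Structure B]
    {G : Subgroup (Equiv.Perm B)} (hG : G ≤ autGroup L B) (hGo : IsOligomorphic G)
    (h : ∀ r : ℕ, 3 ≤ r → ¬ PPConstructs L B structD (structK r)) :
    SatisfiesModulo L B (groupClosure G) siggers4 := by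
  have := satisfiesModulo_of_graph hG hGo ![![0, 1, 2, 0], ![1, 2, 0, 2] ]
    (by decide) structD (fun x hx => by
      change (x 0, x 1) ∈ ({(0, 1), (1, 2), (2, 0), (0, 2)} : Set (Fin 3 × Fin 3)) at hx
      simp only [Set.mem_insert_iff, Set.mem_singleton_iff] at hx
      revert x
      decide) h
  rw [siggers4]
  convert this using 2
  simp only [Matrix.range_cons, Matrix.range_empty, Set.insert_eq, Set.union_empty]

/-! ### Sparse hypergraphs of large chromatic number

Hypergraphs have labeled edges: they are given by a map `ed : E → ι → V`. -/

/-- The vertex `v` lies on an edge in `S` other than `e`. -/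
def OnOther {ι V E : Type*} (ed : E → ι → V) (S : Finset E) (e : E) (v : V) : Prop :=
  ∃ e' ∈ S, e' ≠ e ∧ ∃ i, ed e' i = v

/-- Every non-empty set of at most `s` edges has an edge sharing at most one vertex with the other
edges of the set. -/
def Sparse {ι V E : Type*} (ed : E → ι → V) (s : ℕ) : Prop :=
  ∀ S : Finset E, S.Nonempty → S.card ≤ s →
    ∃ e ∈ S, ∀ i i', OnOther ed S e (ed e i) → OnOther ed S e (ed e i') → i = i'

/-- In a sparse hypergraph, the leaf of a set of edges can be chosen away from a given vertex. -/
theorem Sparse.exists_leaf {ι V E : Type*} {ed : E → ι → V} {s : ℕ} (h : Sparse ed s)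
    (hed : ∀ e, Function.Injective (ed e)) (S : Finset E) (hS : S.Nonempty) (hSs : S.card ≤ s)
    (Z : Set V) (hZ : Z.Subsingleton) :
    ∃ e ∈ S, ∀ i i', OnOther ed S e (ed e i) ∨ ed e i ∈ Z →
      OnOther ed S e (ed e i') ∨ ed e i' ∈ Z → i = i' := by
  classical
  induction S using Finset.strongInduction generalizing Z with
  | H S ih =>
    obtain ⟨e, he, hleaf⟩ := h S hS hSs
    by_cases hgood : ∀ i i', OnOther ed S e (ed e i) ∨ ed e i ∈ Z →
      OnOther ed S e (ed e i') ∨ ed e i' ∈ Z → i = i'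
    · exact ⟨e, he, hgood⟩
    -- If the leaf `e` fails, the marked vertex is private to `e`. Then `e` is removed and its
    -- unique shared vertex is marked instead: a leaf of the rest away from that vertex remains one
    -- in `S`.
    obtain ⟨j, j', hj, hjZ, hj'⟩ : ∃ j j', ¬ OnOther ed S e (ed e j) ∧ ed e j ∈ Z ∧
        OnOther ed S e (ed e j') := by
      push Not at hgood
      obtain ⟨j, j', h₁, h₂, hne⟩ := hgood
      rcases h₁ with h₁ | h₁
      · rcases h₂ with h₂ | h₂
        · exact absurd (hleaf _ _ h₁ h₂) hne
        · by_cases h₃ : OnOther ed S e (ed e j')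
          · exact absurd (hleaf _ _ h₁ h₃) hne
          · exact ⟨j', j, h₃, h₂, h₁⟩
      · by_cases h₃ : OnOther ed S e (ed e j)
        · rcases h₂ with h₂ | h₂
          · exact absurd (hleaf _ _ h₃ h₂) hne
          · by_cases h₄ : OnOther ed S e (ed e j')
            · exact absurd (hleaf _ _ h₃ h₄) hne
            · exact ⟨j', j, h₄, h₂, h₃⟩
        · rcases h₂ with h₂ | h₂
          · exact ⟨j, j', h₃, h₁, h₂⟩
          · exact absurd (hed e (hZ h₁ h₂)) hne
    have hne : (S.erase e).Nonempty := by
      obtain ⟨e', he', hne, -⟩ := hj'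
      exact ⟨e', Finset.mem_erase.2 ⟨hne, he'⟩⟩
    obtain ⟨e', he', hleaf'⟩ := ih (S.erase e) (Finset.erase_ssubset he) hne
      ((Finset.card_erase_le).trans hSs) {ed e j'} Set.subsingleton_singleton
    obtain ⟨hee, heS⟩ := Finset.mem_erase.1 he'
    have key : ∀ i, OnOther ed S e' (ed e' i) ∨ ed e' i ∈ Z →
        OnOther ed (S.erase e) e' (ed e' i) ∨ ed e' i ∈ ({ed e j'} : Set V) := by
      rintro i (⟨e'', h₁, h₂, l, h₃⟩ | hi)
      · by_cases hE : e'' = e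
        · subst hE
          have : OnOther ed S e'' (ed e'' l) := ⟨e', heS, hee, i, h₃.symm⟩
          rw [hleaf _ _ this hj'] at h₃
          exact .inr h₃.symm
        · exact .inl ⟨e'', Finset.mem_erase.2 ⟨hE, h₁⟩, h₂, l, h₃⟩
      · exact absurd ⟨e', heS, hee, i, hZ hi hjZ⟩ hj
    exact ⟨e', heS, fun i i' hi hi' => hleaf' i i' (key i hi) (key i' hi')⟩

/-- The vertices of an amalgam of copies of a partite hypergraph, glued along the part `k`: the
vertices of that part are replaced with vertices of `V'`. -/
abbrev AmalgamVertex {V K : Type} (part : V → K) (k : K) (V' E' : Type) : Type :=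
  V' ⊕ E' × {v : V // part v ≠ k}

open Classical in
/-- The embedding of the copy with index `c` into the amalgam. -/
noncomputable def amalgamEmb {V K : Type} (part : V → K) (k : K) {V' E' : Type}
    (ed' : E' → {v : V // part v = k} → V') (c : E') (v : V) : AmalgamVertex part k V' E' :=
  if h : part v = k then .inl (ed' c ⟨v, h⟩) else .inr (c, ⟨v, h⟩)

theorem amalgamEmb_eq {V K : Type} (part : V → K) (k : K) {V' E' : Type}
    {ed' : E' → {v : V // part v = k} → V'} {c c' : E'} {v v' : V}
    (h : amalgamEmb part k ed' c v = amalgamEmb part k ed' c' v') :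
    (c = c' ∧ v = v') ∨ ∃ (hv : part v = k) (hv' : part v' = k), ed' c ⟨v, hv⟩ = ed' c' ⟨v', hv'⟩ := by
  by_cases h₁ : part v = k <;> by_cases h₂ : part v' = k <;>
    simp only [amalgamEmb, h₁, h₂, dif_pos, dif_neg, not_false_eq_true, Sum.inl.injEq,
      Sum.inr.injEq, Prod.mk.injEq, Subtype.mk.injEq, reduceCtorEq] at h
  · exact .inr ⟨h₁, h₂, h⟩
  · exact .inl h

/-- Copies meet only in part `k`, as prescribed by `ed'`. Among the copies touched by `S` there is a
leaf copy, attached to the others at no more than one vertex; inside it `Sparse.exists_leaf` finds a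
leaf edge avoiding that attachment. -/
theorem sparse_amalgam {ι V E K V' E' : Type} {ed : E → ι → V} {part : V → K}
    (hpart : ∀ e, Function.Injective fun i => part (ed e i)) (k : K)
    {ed' : E' → {v : V // part v = k} → V'} (hed' : ∀ c, Function.Injective (ed' c)) {s : ℕ}
    (h : Sparse ed (s + 1)) (h' : Sparse ed' s) :
    Sparse (fun (x : E' × E) i => amalgamEmb part k ed' x.1 (ed x.2 i)) (s + 1) := by
  classical
  intro S hS hSs
  by_contra! hcon
  have hed : ∀ e, Function.Injective (ed e) := fun e => (hpart e).of_comp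
  let C := S.image Prod.fst
  -- An edge alone in its copy shares only vertices of part `k`, of which it has at most one, so it
  -- is a leaf. Hence each copy holds two edges of `S`, which is why sparsity `s` of `ed'` suffices
  -- for `s + 1`.
  have hfib : ∀ c ∈ C, 2 ≤ (S.filter fun x => x.1 = c).card := by
    intro c hc
    obtain ⟨x, hx, rfl⟩ := Finset.mem_image.1 hc
    obtain ⟨i, i', hi, hi', hne⟩ := hcon x hx
    by_contra! hlt
    have huniq : ∀ y ∈ S, y ≠ x → y.1 ≠ x.1 := by
      intro y hy hyx h₁
      have : 1 < (S.filter fun z => z.1 = x.1).card :=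
        Finset.one_lt_card.2 ⟨x, by simp [hx], y, by simp [hy, h₁], hyx.symm⟩
      omega
    have hk : ∀ i, OnOther (fun (x : E' × E) i => amalgamEmb part k ed' x.1 (ed x.2 i)) S x
        (amalgamEmb part k ed' x.1 (ed x.2 i)) → part (ed x.2 i) = k := by
      rintro i ⟨y, hy, hyx, l, hl⟩
      rcases amalgamEmb_eq part k hl with ⟨h₁, -⟩ | ⟨-, h₂, -⟩
      · exact absurd h₁ (huniq y hy hyx)
      · exact h₂
    exact hne (hpart x.2 ((hk i hi).trans (hk i' hi').symm))
  have hcard : C.card * 2 ≤ S.card := by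
    rw [Finset.card_eq_sum_card_image Prod.fst S, ← smul_eq_mul]
    exact Finset.card_nsmul_le_sum _ _ _ hfib
  have hCne : C.Nonempty := hS.image _
  have hC : C.card ≤ s := by
    have := hCne.card_pos
    omega
  obtain ⟨c, hc, hleaf⟩ := h' C hCne hC
  let Sc : Finset E := (S.filter fun x => x.1 = c).image Prod.snd
  have hSc : ∀ e, e ∈ Sc ↔ (c, e) ∈ S := by
    intro e
    simp only [Sc, Finset.mem_image, Finset.mem_filter, Prod.exists]
    constructor
    · rintro ⟨a, b, ⟨h₁, rfl⟩, rfl⟩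
      exact h₁
    · exact fun h₁ => ⟨c, e, ⟨h₁, rfl⟩, rfl⟩
  have hScne : Sc.Nonempty := by
    obtain ⟨⟨a, e⟩, hx, rfl⟩ := Finset.mem_image.1 hc
    exact ⟨e, (hSc e).2 hx⟩
  have hSccard : Sc.card ≤ s + 1 :=
    (Finset.card_image_le.trans (Finset.card_filter_le _ _)).trans hSs
  obtain ⟨e, he, hleafe⟩ := h.exists_leaf hed Sc hScne hSccard
    {v | ∃ hv : part v = k, OnOther ed' C c (ed' c ⟨v, hv⟩)} (by
      rintro v ⟨hv, h₁⟩ v' ⟨hv', h₂⟩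
      exact congrArg Subtype.val (hleaf _ _ h₁ h₂))
  obtain ⟨i, i', hi, hi', hne⟩ := hcon (c, e) ((hSc e).1 he)
  have key : ∀ i, OnOther (fun (x : E' × E) i => amalgamEmb part k ed' x.1 (ed x.2 i)) S (c, e)
      (amalgamEmb part k ed' c (ed e i)) → OnOther ed Sc e (ed e i) ∨
      ed e i ∈ {v | ∃ hv : part v = k, OnOther ed' C c (ed' c ⟨v, hv⟩)} := by
    rintro i ⟨⟨c', e'⟩, hx, hxne, l, hl⟩
    by_cases hcc : c' = c
    · subst hcc
      refine .inl ⟨e', (hSc e').2 hx, fun h => hxne (by rw [h]), l, ?_⟩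
      rcases amalgamEmb_eq part k hl with ⟨-, h₂⟩ | ⟨h₁, h₂, h₃⟩
      · exact h₂
      · exact congrArg Subtype.val (hed' _ h₃)
    · rcases amalgamEmb_eq part k hl with ⟨h₁, -⟩ | ⟨h₁, h₂, h₃⟩
      · exact absurd h₁ hcc
      · exact .inr ⟨h₂, c', Finset.mem_image_of_mem _ hx, hcc, _, h₃⟩
  exact hne (hleafe _ _ (key _ hi) (key _ hi'))

/-- There are sparse hypergraphs of arbitrary finite uniformity and large chromatic number; the
proof is the partite construction of Nešetřil and Rödl. -/
theorem exists_sparse_not_colorable {r : ℕ} (hr : 0 < r) (s : ℕ) :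
    ∀ (ι : Type) [Finite ι],
    ∃ (V E : Type) (_ : Finite V) (_ : Finite E) (ed : E → ι → V),
      (∀ e, Function.Injective (ed e)) ∧ Sparse ed s ∧
      ∀ c : V → Fin r, ∃ e, ∀ i i', c (ed e i) = c (ed e i') := by
  classical
  have pigeonhole : ∀ (ι : Type) [Finite ι], ∃ K : Type, Finite K ∧ ∀ c : K → Fin r,
      ∃ ε : ι ↪ K, ∀ i i', c (ε i) = c (ε i') := by
    intro ι _
    have := Fintype.ofFinite ι
    refine ⟨Fin (r * Fintype.card ι + 1), inferInstance, fun c => ?_⟩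
    obtain ⟨y, hy⟩ := Fintype.exists_lt_card_fiber_of_mul_lt_card (n := Fintype.card ι) c
      (by simp)
    obtain ⟨ε⟩ : Nonempty (ι ↪ {x // x ∈ Finset.univ.filter fun x => c x = y}) := by
      apply Function.Embedding.nonempty_of_card_le
      simpa [Fintype.card_subtype] using hy.le
    refine ⟨ε.trans (Function.Embedding.subtype _), fun i i' => ?_⟩
    have hi := fun i => (Finset.mem_filter.1 (ε i).2).2
    exact (hi i).trans (hi i').symm
  induction s with
  | zero =>
    intro ι _
    obtain ⟨K, _, hK⟩ := pigeonhole ι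
    have : Finite (ι ↪ K) := Finite.of_injective _ DFunLike.coe_injective
    refine ⟨K, ι ↪ K, inferInstance, inferInstance, fun ε => ε, fun ε => ε.injective, ?_, hK⟩
    intro S hS hS0
    have := hS.card_pos
    omega
  | succ s ih =>
    intro ι _
    obtain ⟨K, _, hK⟩ := pigeonhole ι
    have : Finite (ι ↪ K) := Finite.of_injective _ DFunLike.coe_injective
    -- The parts are made monochromatic one at a time. Once `Q` is everything, `γ` colours the parts
    -- and the pigeonhole principle yields a transversal `ε` of one colour.
    suffices H : ∀ Q : Finset K, ∃ (V E : Type) (_ : Finite V) (_ : Finite E) (ed : E → ι → V)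
        (part : V → K), (∀ e, Function.Injective fun i => part (ed e i)) ∧ Sparse ed (s + 1) ∧
        ∀ c : V → Fin r, ∃ γ : K → Fin r, ∀ ε : ι ↪ K, ∃ e, ∀ i, part (ed e i) = ε i ∧
          (ε i ∈ Q → c (ed e i) = γ (ε i)) by
      have := Fintype.ofFinite K
      obtain ⟨V, E, hV, hE, ed, part, h₁, h₂, h₃⟩ := H Finset.univ
      refine ⟨V, E, hV, hE, ed, fun e => (h₁ e).of_comp, h₂, fun c => ?_⟩
      obtain ⟨γ, hγ⟩ := h₃ c
      obtain ⟨ε, hε⟩ := hK γ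
      obtain ⟨e, he⟩ := hγ ε
      refine ⟨e, fun i i' => ?_⟩
      rw [(he i).2 (Finset.mem_univ _), (he i').2 (Finset.mem_univ _), hε i i']
    intro Q
    induction Q using Finset.induction_on with
    | empty =>
      refine ⟨(ι ↪ K) × ι, ι ↪ K, inferInstance, inferInstance, fun ε i => (ε, i),
        fun x => x.1 x.2, fun ε => ε.injective, ?_, fun c => ?_⟩
      · rintro S ⟨ε, hε⟩ -
        refine ⟨ε, hε, fun i i' hi => ?_⟩
        obtain ⟨ε', -, hne, l, hl⟩ := hi
        exact absurd (congrArg Prod.fst hl) hne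
      · exact ⟨fun _ => ⟨0, hr⟩, fun ε => ⟨ε, fun i => ⟨rfl, by simp⟩⟩⟩
    | insert k Q hk ihQ =>
      obtain ⟨V, E, _, _, ed, part, h₁, h₂, h₃⟩ := ihQ
      -- The uniformity is now the size of part `k`, so the induction on sparsity must cover all
      -- uniformities. A monochromatic edge of `ed'` is a copy whose part `k` has one colour.
      obtain ⟨V', E', _, _, ed', h₁', h₂', h₃'⟩ := ih {v : V // part v = k}
      refine ⟨AmalgamVertex part k V' E', E' × E,
        inferInstanceAs (Finite (V' ⊕ E' × {v : V // part v ≠ k})), inferInstance,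
        fun x i => amalgamEmb part k ed' x.1 (ed x.2 i), Sum.elim (fun _ => k) fun y => part y.2.1,
        ?_, sparse_amalgam h₁ k h₁' h₂ h₂', fun c => ?_⟩
      all_goals
        have hemb : ∀ g v, (Sum.elim (fun _ => k) fun y => part y.2.1 :
            AmalgamVertex part k V' E' → K) (amalgamEmb part k ed' g v) = part v := by
          intro g v
          by_cases h : part v = k <;> simp [amalgamEmb, h]
      · intro x
        simpa only [hemb] using h₁ x.2
      · obtain ⟨g, hg⟩ := h₃' fun v => c (.inl v)
        obtain ⟨γ, hγ⟩ := h₃ fun v => c (amalgamEmb part k ed' g v)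
        refine ⟨fun l => if h : l = k ∧ ∃ v, part v = k then
          c (.inl (ed' g ⟨h.2.choose, h.2.choose_spec⟩)) else γ l, fun ε => ?_⟩
        obtain ⟨e, he⟩ := hγ ε
        refine ⟨(g, e), fun i => ⟨(hemb _ _).trans (he i).1, fun hi => ?_⟩⟩
        by_cases hik : ε i = k
        · have hek : part (ed e i) = k := (he i).1.trans hik
          beta_reduce
          rw [dif_pos ⟨hik, _, hek⟩]
          dsimp only
          rw [amalgamEmb, dif_pos hek]
          exact hg _ _
        · beta_reduce
          rw [dif_neg fun h => hik h.1]
          exact (he i).2 (Finset.mem_of_mem_insert_of_ne hi hik)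

/-! ### Local solvability of one-in-`k` instances on sparse hypergraphs -/

/-- The values `χ` of the vertices form a solution of the one-in-`k` constraints given by the edges
in `T`, where `o e` is the position of the unique vertex of value `0` of the edge `e`. -/
def IsSolutionOn {V E : Type*} {k : ℕ} (ed : E → Fin k → V) (T : Finset E) (χ : V → Fin 2)
    (o : E → Fin k) : Prop :=
  ∀ e ∈ T, ∀ i, χ (ed e i) = if o e = i then 0 else 1

/-- The vertex `v` lies on an edge in `R`, and on no edge in `T \ R`. -/
def IsFree {ι V E : Type*} (ed : E → ι → V) (T R : Finset E) (v : V) : Prop :=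
  (∃ e ∈ R, ∃ i, ed e i = v) ∧ ∀ e ∈ T, e ∉ R → ∀ i, ed e i ≠ v

/-- The edges in `R` can be removed from `T`: solutions on `T \ R` extend to `T` by a change of the
values of the free vertices. -/
structure IsReducible {ι V E : Type*} (ed : E → ι → V) (T R : Finset E) : Prop where
  subset : R ⊆ T
  eq_of_not_isFree : ∀ e ∈ R, ∀ i i', ¬ IsFree ed T R (ed e i) → ¬ IsFree ed T R (ed e i') → i = i'
  exists_isFree : ∀ e ∈ R, ∃ i, IsFree ed T R (ed e i) ∧ ∀ e' ∈ R, ∀ i', ed e' i' = ed e i → e' = e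

/-- Each edge of `R` has at most one vertex with a prescribed value. If that value is 0, the edge
takes its 0 there; otherwise it takes it at a free vertex on no other edge of `R`. All remaining
free vertices get 1. -/
theorem IsReducible.extend {V E : Type*} [DecidableEq E] {k : ℕ} {ed : E → Fin k → V}
    (hed : ∀ e, Function.Injective (ed e)) {T R : Finset E} (h : IsReducible ed T R)
    {χ : V → Fin 2} {o : E → Fin k} (hs : IsSolutionOn ed (T \ R) χ o) :
    ∃ χ' o', IsSolutionOn ed T χ' o' ∧ (∀ v, ¬ IsFree ed T R v → χ' v = χ v) ∧
      ∀ e, e ∉ R → o' e = o e := by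
  classical
  have hpos : ∀ e, ∃ j : Fin k, e ∈ R →
      (¬ IsFree ed T R (ed e j) ∧ χ (ed e j) = 0) ∨
      ((∀ i, ¬ IsFree ed T R (ed e i) → χ (ed e i) ≠ 0) ∧ IsFree ed T R (ed e j) ∧
        ∀ e' ∈ R, ∀ i', ed e' i' = ed e j → e' = e) := by
    intro e
    by_cases he : e ∈ R
    · by_cases hex : ∃ j, ¬ IsFree ed T R (ed e j) ∧ χ (ed e j) = 0
      · obtain ⟨j, hj⟩ := hex
        exact ⟨j, fun _ => .inl hj⟩
      · push Not at hex
        obtain ⟨j, hj, hj'⟩ := h.exists_isFree e he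
        exact ⟨j, fun _ => .inr ⟨hex, hj, hj'⟩⟩
    · exact ⟨o e, fun he' => absurd he' he⟩
  choose p hp using hpos
  refine ⟨fun v => if IsFree ed T R v then (if ∃ e ∈ R, ed e (p e) = v then 0 else 1) else χ v,
    fun e => if e ∈ R then p e else o e, fun e he i => ?_, fun v hv => if_neg hv,
    fun e he => if_neg he⟩
  by_cases heR : e ∈ R
  · simp only [heR, if_true]
    by_cases hf : IsFree ed T R (ed e i)
    · simp only [hf, if_true]
      congr 1
      refine propext ⟨?_, fun hi => ⟨e, heR, by rw [hi]⟩⟩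
      rintro ⟨e', he', hi⟩
      rcases hp e' he' with h₁ | h₁
      · rw [hi] at h₁
        exact absurd hf h₁.1
      · obtain rfl := h₁.2.2 e heR i hi.symm
        exact hed _ hi
    · simp only [hf, if_false]
      rcases hp e heR with h₁ | h₁
      · obtain rfl := h.eq_of_not_isFree e heR _ _ h₁.1 hf
        simpa using h₁.2
      · have hne : p e ≠ i := by
          rintro rfl
          exact hf h₁.2.1
        have := h₁.1 i hf
        rw [if_neg hne]
        omega
  · have hf : ¬ IsFree ed T R (ed e i) := fun hf => hf.2 e he heR i rfl
    simp only [hf, heR, if_false]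
    exact hs e (Finset.mem_sdiff.2 ⟨he, heR⟩) i

/-- Restoring a leaf edge adds at least k − 1 new vertices. -/
theorem Sparse.mul_card_le {V E : Type*} [DecidableEq V] {k : ℕ} {ed : E → Fin k → V} {s : ℕ}
    (h : Sparse ed s) (hed : ∀ e, Function.Injective (ed e)) (T : Finset E) (hT : T.card ≤ s) :
    k * T.card ≤ (T.biUnion fun e => Finset.univ.image (ed e)).card + T.card := by
  classical
  induction T using Finset.strongInduction with
  | H T ih =>
    rcases T.eq_empty_or_nonempty with rfl | hne
    · simp
    obtain ⟨e, he, hleaf⟩ := h T hne hT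
    have hcard := Finset.card_erase_add_one he
    have hT' := ih (T.erase e) (Finset.erase_ssubset he) (by omega)
    let U' := (T.erase e).biUnion fun e => Finset.univ.image (ed e)
    let F : Finset (Fin k) := Finset.univ.filter fun i => ed e i ∉ U'
    have hF : k ≤ F.card + 1 := by
      have h₁ : (Finset.univ.filter fun i => ¬ ed e i ∉ U').card ≤ 1 := by
        refine Finset.card_le_one.2 fun i hi i' hi' => hleaf i i' ?_ ?_
        · simp only [U', Finset.mem_filter, Finset.mem_univ, true_and, not_not, Finset.mem_biUnion,
            Finset.mem_erase, Finset.mem_image] at hi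
          obtain ⟨e', ⟨h₁, h₂⟩, h₃⟩ := hi
          exact ⟨e', h₂, h₁, h₃⟩
        · simp only [U', Finset.mem_filter, Finset.mem_univ, true_and, not_not, Finset.mem_biUnion,
            Finset.mem_erase, Finset.mem_image] at hi'
          obtain ⟨e', ⟨h₁, h₂⟩, h₃⟩ := hi'
          exact ⟨e', h₂, h₁, h₃⟩
      have h₂ := Finset.card_filter_add_card_filter_not (s := (Finset.univ : Finset (Fin k)))
        fun i => ed e i ∉ U'
      rw [Finset.card_fin] at h₂
      change F.card + _ = _ at h₂
      omega
    have hU : U'.card + F.card ≤ (T.biUnion fun e => Finset.univ.image (ed e)).card := by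
      rw [← Finset.card_image_of_injective F (hed e), ← Finset.card_union_of_disjoint]
      · refine Finset.card_le_card (Finset.union_subset
          (Finset.biUnion_subset_biUnion_of_subset_left _ (Finset.erase_subset _ _)) ?_)
        exact (Finset.image_subset_image (Finset.subset_univ _)).trans
          (Finset.subset_biUnion_of_mem (fun e => Finset.univ.image (ed e)) he)
      · refine Finset.disjoint_right.2 fun v hv => ?_
        obtain ⟨i, hi, rfl⟩ := Finset.mem_image.1 hv
        exact (Finset.mem_filter.1 hi).2
    change k * _ ≤ U'.card + _ at hT'
    rw [← hcard, mul_add]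
    omega

/-- `R` is either a single edge with at most one shared vertex, or two edges through a vertex of
degree 2, each with just one further shared vertex. If no single edge works, the forest-like vertex
count forces nearly |T| vertices of degree 2, and few of these are spoiled by `DV` and `DE`. -/
theorem exists_isReducible {V E : Type*} {k : ℕ} (hk : 3 ≤ k) {ed : E → Fin k → V}
    (hed : ∀ e, Function.Injective (ed e)) {s : ℕ} (h : Sparse ed s) {T : Finset E}
    (hT : T.card ≤ s) {w : ℕ} {DV : Finset V} {DE : Finset E} (hDV : DV.card ≤ w)
    (hDE : DE.card ≤ w) (hw : (9 + 6 * k) * w < T.card) :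
    ∃ R : Finset E, R.Nonempty ∧ IsReducible ed T R ∧ (∀ e ∈ R, e ∉ DE) ∧
      ∀ v ∈ DV, ¬ IsFree ed T R v := by
  classical
  by_contra! hcon
  let U := T.biUnion fun e => Finset.univ.image (ed e)
  let deg : V → ℕ := fun v => (T.filter fun e => ∃ i, ed e i = v).card
  let sh : E → Finset (Fin k) := fun e => Finset.univ.filter fun i => OnOther ed T e (ed e i)
  -- `P` collects the edges whose removal would touch `DE` or a private vertex in `DV`; `Q` collects
  -- those with too many shared vertices for the second choice of `R`.
  let P := T.filter fun e => e ∈ DE ∨ ∃ i, ed e i ∈ DV ∧ ¬ OnOther ed T e (ed e i)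
  let Q := T.filter fun e => 3 ≤ (sh e).card
  have hnotP : ∀ e ∈ T, e ∉ P → e ∉ DE ∧ ∀ i, ed e i ∈ DV → OnOther ed T e (ed e i) := by
    intro e he heP
    simp only [P, Finset.mem_filter, he, true_and, not_or, not_exists, not_and, not_not] at heP
    exact heP
  have hsh : ∀ e ∈ T, e ∉ P → 2 ≤ (sh e).card := by
    intro e he heP
    obtain ⟨h₁, h₂⟩ := hnotP e he heP
    by_contra! hlt
    have hfree : ∀ i, ¬ OnOther ed T e (ed e i) → IsFree ed T {e} (ed e i) := by
      intro i hi
      refine ⟨⟨e, Finset.mem_singleton_self e, i, rfl⟩, fun e' he' hne i' hi' => hi ?_⟩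
      exact ⟨e', he', by simpa using hne, i', hi'⟩
    obtain ⟨v, hv, hvf⟩ := hcon {e} (Finset.singleton_nonempty e)
      { subset := Finset.singleton_subset_iff.2 he
        eq_of_not_isFree := by
          intro e' he' i i' hi hi'
          obtain rfl := Finset.mem_singleton.1 he'
          refine Finset.card_le_one.1 (Nat.lt_succ_iff.1 hlt) i ?_ i' ?_
          · simp only [sh, Finset.mem_filter, Finset.mem_univ, true_and]
            exact not_imp_comm.1 (hfree i) hi
          · simp only [sh, Finset.mem_filter, Finset.mem_univ, true_and]
            exact not_imp_comm.1 (hfree i') hi'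
        exists_isFree := by
          intro e' he'
          obtain rfl := Finset.mem_singleton.1 he'
          obtain ⟨i, hi⟩ : ∃ i, i ∉ sh e' := by
            by_contra! hall
            have := Finset.card_le_card (fun i _ => hall i : Finset.univ ⊆ sh e')
            rw [Finset.card_fin] at this
            omega
          refine ⟨i, hfree i (by simpa [sh] using hi), fun e'' he'' _ _ => ?_⟩
          exact Finset.mem_singleton.1 he'' }
      (by simpa using h₁)
    obtain ⟨⟨e', he', i, rfl⟩, hv'⟩ := hvf
    obtain rfl := Finset.mem_singleton.1 he'
    obtain ⟨e'', h₃, h₄, i', h₅⟩ := h₂ i hv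
    exact hv' e'' h₃ (by simpa using h₄) i' h₅
  have hP : P.card ≤ 2 * w := by
    have hsub : P ⊆ DE ∪ DV.biUnion fun v => T.filter fun e =>
        ∃ i, ed e i = v ∧ ¬ OnOther ed T e v := by
      intro e he
      obtain ⟨heT, he | ⟨i, hi, hi'⟩⟩ := Finset.mem_filter.1 he
      · exact Finset.mem_union_left _ he
      · exact Finset.mem_union_right _ (Finset.mem_biUnion.2
          ⟨_, hi, Finset.mem_filter.2 ⟨heT, i, rfl, hi'⟩⟩)
    have h₁ := Finset.card_biUnion_le_card_mul DV (fun v => T.filter fun e =>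
      ∃ i, ed e i = v ∧ ¬ OnOther ed T e v) 1 (fun v _ => by
        refine Finset.card_le_one.2 fun e he e' he' => ?_
        obtain ⟨heT, i, rfl, hi⟩ := Finset.mem_filter.1 he
        obtain ⟨heT', i', hi', -⟩ := Finset.mem_filter.1 he'
        by_contra hne
        exact hi ⟨e', heT', Ne.symm hne, i', hi'⟩)
    have h₂ := (Finset.card_le_card hsub).trans (Finset.card_union_le _ _)
    omega
  have hcount : k * T.card ≤ U.card + T.card := h.mul_card_le hed T hT
  have hdeg : ∑ v ∈ U, deg v = k * T.card := by
    have h₁ := Finset.sum_card_bipartiteAbove_eq_sum_card_bipartiteBelow (s := U) (t := T)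
      fun v e => ∃ i, ed e i = v
    refine h₁.trans ?_
    rw [mul_comm, ← smul_eq_mul, ← Finset.sum_const]
    refine Finset.sum_congr rfl fun e he => ?_
    refine Eq.trans ?_
      ((Finset.card_image_of_injective Finset.univ (hed e)).trans (Finset.card_fin k))
    congr 1
    ext v
    simp only [Finset.bipartiteBelow, Finset.mem_filter, Finset.mem_image, Finset.mem_univ,
      true_and, U, Finset.mem_biUnion]
    exact ⟨fun h => h.2, fun h => ⟨⟨e, he, h⟩, h⟩⟩
  let U₁ := U.filter fun v => deg v = 1
  let U₂ := U.filter fun v => deg v = 2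
  let U₃ := U.filter fun v => 3 ≤ deg v
  have hdegpos : ∀ v ∈ U, 1 ≤ deg v := by
    intro v hv
    obtain ⟨e, he, hev⟩ := Finset.mem_biUnion.1 hv
    obtain ⟨i, -, hi⟩ := Finset.mem_image.1 hev
    exact Finset.card_pos.2 ⟨e, Finset.mem_filter.2 ⟨he, i, hi⟩⟩
  have hU : U.card = U₁.card + U₂.card + U₃.card := by
    simp only [U₁, U₂, U₃, Finset.card_filter, ← Finset.sum_add_distrib]
    rw [Finset.card_eq_sum_ones]
    refine Finset.sum_congr rfl fun v hv => ?_
    have := hdegpos v hv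
    split_ifs <;> omega
  have hUdeg : U₁.card + 2 * U₂.card + 3 * U₃.card ≤ k * T.card := by
    rw [← hdeg]
    simp only [U₁, U₂, U₃, Finset.card_filter, Finset.mul_sum, ← Finset.sum_add_distrib]
    refine Finset.sum_le_sum fun v hv => ?_
    split_ifs <;> omega
  have hU₁ : U₁.card + ∑ e ∈ T, (sh e).card ≤ k * T.card := by
    have hsub : U₁ ⊆ T.biUnion fun e => (Finset.univ \ sh e).image (ed e) := by
      intro v hv
      obtain ⟨hvU, hv1⟩ := Finset.mem_filter.1 hv
      obtain ⟨e, he, hev⟩ := Finset.mem_biUnion.1 hvU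
      obtain ⟨i, -, rfl⟩ := Finset.mem_image.1 hev
      refine Finset.mem_biUnion.2 ⟨e, he, Finset.mem_image_of_mem _ ?_⟩
      simp only [sh, Finset.mem_sdiff, Finset.mem_univ, true_and, Finset.mem_filter]
      rintro ⟨e', he', hne, i', hi'⟩
      exact hne (Finset.card_le_one.1 hv1.le e' (Finset.mem_filter.2 ⟨he', i', hi'⟩) e
        (Finset.mem_filter.2 ⟨he, i, rfl⟩))
    have h₁ : U₁.card ≤ ∑ e ∈ T, (Finset.univ \ sh e).card :=
      ((Finset.card_le_card hsub).trans Finset.card_biUnion_le).trans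
        (Finset.sum_le_sum fun e _ => Finset.card_image_le)
    have h₂ : ∑ e ∈ T, (Finset.univ \ sh e).card + ∑ e ∈ T, (sh e).card = k * T.card := by
      rw [← Finset.sum_add_distrib, mul_comm, ← smul_eq_mul, ← Finset.sum_const]
      refine Finset.sum_congr rfl fun e _ => ?_
      rw [Finset.card_sdiff_add_card_eq_card (Finset.subset_univ _), Finset.card_fin]
    omega
  have hshsum : 2 * T.card + Q.card ≤ ∑ e ∈ T, (sh e).card + 2 * P.card := by
    rw [Finset.card_eq_sum_ones T]
    simp only [P, Q, Finset.card_filter, Finset.mul_sum, ← Finset.sum_add_distrib]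
    refine Finset.sum_le_sum fun e he => ?_
    have := hsh e he
    simp only [P, Finset.mem_filter, he, true_and] at this
    by_cases hp : e ∈ DE ∨ ∃ i, ed e i ∈ DV ∧ ¬ OnOther ed T e (ed e i)
    · simp only [hp, if_true]
      split_ifs <;> omega
    · have := this hp
      simp only [hp, if_false]
      split_ifs <;> omega
  have hbad : (DV ∪ (P ∪ Q).biUnion fun e => Finset.univ.image (ed e)).card ≤
      w + 6 * (k * w) := by
    have hQ : Q.card ≤ 4 * w := by
      generalize k * T.card = x at *
      omega
    have h₁ := Finset.card_biUnion_le_card_mul (P ∪ Q) (fun e => Finset.univ.image (ed e)) k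
      (fun e _ => by
        rw [Finset.card_image_of_injective _ (hed e), Finset.card_fin])
    have h₂ : (P ∪ Q).card * k ≤ (6 * w) * k :=
      Nat.mul_le_mul_right k ((Finset.card_union_le _ _).trans (by omega))
    have h₃ : 6 * w * k = 6 * (k * w) := by ring
    have h₄ := Finset.card_union_le DV ((P ∪ Q).biUnion fun e => Finset.univ.image (ed e))
    omega
  -- The counts give |U₂| ≥ |T| − 4|P| ≥ |T| − 8w, while at most w + 6kw vertices are excluded; this
  -- is the source of the constant 9 + 6k.
  obtain ⟨c, hcU, hc⟩ : ∃ c ∈ U₂, c ∉ DV ∪ (P ∪ Q).biUnion fun e => Finset.univ.image (ed e) := by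
    by_contra! hsub
    have h₁ := Finset.card_le_card hsub
    have h₂ : (9 + 6 * k) * w = 9 * w + 6 * (k * w) := by ring
    generalize k * T.card = x at *
    generalize k * w = y at *
    omega
  obtain ⟨e₁, e₂, hne, hE⟩ := Finset.card_eq_two.1 (Finset.mem_filter.1 hcU).2
  simp only [Finset.mem_union, not_or, Finset.mem_biUnion, not_exists, not_and] at hc
  obtain ⟨hcDV, hcPQ⟩ := hc
  have hER : ∀ e, e ∈ ({e₁, e₂} : Finset E) ↔ e ∈ T ∧ ∃ i, ed e i = c := fun e => by
    rw [← hE, Finset.mem_filter]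
  have hgood : ∀ e ∈ ({e₁, e₂} : Finset E), e ∈ T ∧ e ∉ P ∧ (sh e).card = 2 := by
    intro e he
    obtain ⟨heT, i, hi⟩ := (hER e).1 he
    have hmem : c ∈ Finset.univ.image (ed e) := Finset.mem_image.2 ⟨i, Finset.mem_univ _, hi⟩
    have h₁ : e ∉ P := fun h => hcPQ e (.inl h) hmem
    have h₂ : e ∉ Q := fun h => hcPQ e (.inr h) hmem
    simp only [Q, Finset.mem_filter, heT, true_and] at h₂
    exact ⟨heT, h₁, by have := hsh e heT h₁; omega⟩
  have hfree : ∀ e ∈ ({e₁, e₂} : Finset E), ∀ i, ¬ OnOther ed T e (ed e i) →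
      IsFree ed T {e₁, e₂} (ed e i) := by
    intro e he i hi
    refine ⟨⟨e, he, i, rfl⟩, fun e' he' hne' i' hi' => hi ⟨e', he', ?_, i', hi'⟩⟩
    rintro rfl
    exact hne' he
  have hc_free : IsFree ed T {e₁, e₂} c :=
    ⟨⟨e₁, by simp, ((hER e₁).1 (by simp)).2⟩, fun e he hne' i hi => hne' ((hER e).2 ⟨he, i, hi⟩)⟩
  obtain ⟨v, hv, hvf⟩ := hcon {e₁, e₂} ⟨e₁, by simp⟩
    { subset := fun e he => (hgood e he).1
      eq_of_not_isFree := by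
        intro e he i i' hi hi'
        obtain ⟨heT, heP, hcard⟩ := hgood e he
        obtain ⟨-, l, hl⟩ := (hER e).1 he
        by_contra hii
        have hil : i ≠ l := by rintro rfl; exact hi (hl ▸ hc_free)
        have hil' : i' ≠ l := by rintro rfl; exact hi' (hl ▸ hc_free)
        have hsub : {i, i', l} ⊆ sh e := by
          intro j hj
          simp only [sh, Finset.mem_filter, Finset.mem_univ, true_and]
          simp only [Finset.mem_insert, Finset.mem_singleton] at hj
          rcases hj with rfl | rfl | rfl
          · exact not_imp_comm.1 (hfree e he _) hi
          · exact not_imp_comm.1 (hfree e he _) hi'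
          · rw [hl]
            simp only [Finset.mem_insert, Finset.mem_singleton] at he
            rcases he with rfl | rfl
            · obtain ⟨h₁, h₂⟩ := (hER e₂).1 (by simp)
              exact ⟨e₂, h₁, hne.symm, h₂⟩
            · obtain ⟨h₁, h₂⟩ := (hER e₁).1 (by simp)
              exact ⟨e₁, h₁, hne, h₂⟩
        have := Finset.card_le_card hsub
        rw [Finset.card_eq_three.2 ⟨i, i', l, hii, hil, hil', rfl⟩] at this
        omega
      exists_isFree := by
        intro e he
        obtain ⟨heT, heP, hcard⟩ := hgood e he
        obtain ⟨i, hi⟩ : ∃ i, i ∉ sh e := by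
          by_contra! hall
          have := Finset.card_le_card (fun i _ => hall i : Finset.univ ⊆ sh e)
          rw [Finset.card_fin] at this
          omega
        have hi' : ¬ OnOther ed T e (ed e i) := by simpa [sh] using hi
        refine ⟨i, hfree e he i hi', fun e' he' i' hii => ?_⟩
        by_contra hne'
        exact hi' ⟨e', (hgood e' he').1, hne', i', hii⟩ }
    (fun e he => (hnotP e (hgood e he).1 (hgood e he).2.1).1)
  obtain ⟨⟨e, he, i, rfl⟩, hv'⟩ := hvf
  obtain ⟨e', h₁, h₂, i', h₃⟩ := (hnotP e (hgood e he).1 (hgood e he).2.1).2 i hv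
  have he' : e' ∈ ({e₁, e₂} : Finset E) := by
    by_contra hcon
    exact hv' e' h₁ hcon i' h₃
  obtain ⟨-, l, hl⟩ := (hER e).1 he
  obtain ⟨-, l', hl'⟩ := (hER e').1 he'
  -- Both edges contain `c` and the offending vertex of `DV`. Sparsity of this pair makes the two
  -- vertices equal, but `c` is not in `DV`.
  have hle : ({e, e'} : Finset E).card ≤ s := (Finset.card_le_card (by
    rintro x hx
    simp only [Finset.mem_insert, Finset.mem_singleton] at hx
    rcases hx with rfl | rfl
    exacts [(hgood _ he).1, h₁])).trans hT
  obtain ⟨f, hf, hleaf⟩ := h {e, e'} ⟨e, by simp⟩ hle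
  simp only [Finset.mem_insert, Finset.mem_singleton] at hf
  have hic : ed e i = c := by
    rcases hf with rfl | rfl
    · have := hleaf i l ⟨e', by simp, h₂, i', h₃⟩ ⟨e', by simp, h₂, l', hl'.trans hl.symm⟩
      rw [this, hl]
    · have := hleaf i' l' ⟨e, by simp, h₂.symm, i, h₃.symm⟩
        ⟨e, by simp, h₂.symm, l, hl.trans hl'.symm⟩
      rw [← h₃, this, hl']
  exact hcDV (hic ▸ hv)

/-- On sparse hypergraphs, a constraint involving at most `w` vertices and at most `w` edges is
consistent with large sets of one-in-`k` constraints if it is consistent with small ones. -/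
theorem exists_isSolutionOn_of_small {V E : Type*} {k : ℕ} (hk : 3 ≤ k) {ed : E → Fin k → V}
    (hed : ∀ e, Function.Injective (ed e)) {s : ℕ} (h : Sparse ed s) {w : ℕ} {DV : Finset V}
    {DE : Finset E} (hDV : DV.card ≤ w) (hDE : DE.card ≤ w)
    (Φ : (V → Fin 2) → (E → Fin k) → Prop)
    (hΦ : ∀ χ χ' o o', (∀ v ∈ DV, χ' v = χ v) → (∀ e ∈ DE, o' e = o e) → Φ χ o → Φ χ' o')
    (hsmall : ∀ T : Finset E, T.card ≤ (9 + 6 * k) * w → ∃ χ o, IsSolutionOn ed T χ o ∧ Φ χ o)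
    (T : Finset E) (hT : T.card ≤ s) : ∃ χ o, IsSolutionOn ed T χ o ∧ Φ χ o := by
  classical
  induction T using Finset.strongInduction with
  | H T ih =>
    by_cases hTw : T.card ≤ (9 + 6 * k) * w
    · exact hsmall T hTw
    obtain ⟨R, hRne, hR, hRE, hRV⟩ := exists_isReducible hk hed h hT hDV hDE (not_le.1 hTw)
    obtain ⟨χ, o, hs, hχ⟩ := ih (T \ R) (Finset.sdiff_ssubset hR.subset hRne)
      ((Finset.card_le_card Finset.sdiff_subset).trans hT)
    obtain ⟨χ', o', hs', h₁, h₂⟩ := hR.extend hed hs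
    exact ⟨χ', o', hs', hΦ χ χ' o o' (fun v hv => h₁ v (hRV v hv))
      (fun e he => h₂ e fun heR => hRE e heR he) hχ⟩

/-! ### Bounded width implies weak near-unanimity operations -/

/-- The element of the instance `gadgetStructure` for the `i`-th coordinate of the vertex `v`; it
does not depend on `v` if the evaluation `a i` is constant. -/
noncomputable def gadgetPoint {B : Type w} {V : Type} {d : ℕ} (a : Fin d → Fin 2 → B) (v : V)
    (i : Fin d) : Option V × Fin d :=
  open Classical in (if a i 0 = a i 1 then none else some v, i)

/-- The element `x` represents the argument with index `t` in the copy belonging to the edge `e`. -/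
def Represents {B : Type w} {V E : Type} {k d N : ℕ} (ed : E → Fin k → V) (a : Fin d → Fin 2 → B)
    (idx : Fin k → Fin d → Fin N) (e : E) (t : Fin N)
    (x : (Option V × Fin d) ⊕ (E × Fin N)) : Prop :=
  x = .inr (e, t) ∨ ∃ j i, idx j i = t ∧ x = .inl (gadgetPoint a (ed e j) i)

/-- The instance obtained from a hypergraph by replacing every edge with a copy of the structure
induced by the arguments `ω` in the `k`-th power of `B`. -/
@[reducible]
def gadgetStructure (L : FirstOrder.Language.{u, v}) [L.IsRelational] {B : Type w} [L.Structure B]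
    {V E : Type} {k d N : ℕ} (ed : E → Fin k → V) (a : Fin d → Fin 2 → B)
    (idx : Fin k → Fin d → Fin N) (ω : Fin N → Fin k → B) :
    L.Structure ((Option V × Fin d) ⊕ (E × Fin N)) where
  RelMap {r} R x := ∃ (e : E) (t : Fin r → Fin N), (∀ l, Represents ed a idx e (t l) (x l)) ∧
    ∀ i, FirstOrder.Language.Structure.RelMap R fun l => ω (t l) i

/-- The map from the instance to `B` given by a solution of the one-in-`k` constraints. -/
def gadgetEval {B : Type w} {V E : Type} {k d N : ℕ} (a : Fin d → Fin 2 → B)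
    (ω : Fin N → Fin k → B) (χ : V → Fin 2) (o : E → Fin k) :
    (Option V × Fin d) ⊕ (E × Fin N) → B :=
  Sum.elim (fun p => a p.2 (p.1.elim 0 χ)) fun p => ω p.2 (o p.1)

/-- On the copy of `e`, a one-in-k solution acts as the projection to coordinate `o e`. The value 0
assigned to `none` is harmless, since such points arise only from constant `a i`. -/
theorem Represents.gadgetEval_eq {B : Type w} {V E : Type} {k d N : ℕ} {ed : E → Fin k → V}
    {a : Fin d → Fin 2 → B} {idx : Fin k → Fin d → Fin N} {ω : Fin N → Fin k → B}
    (hidx : ∀ j i, ω (idx j i) = a i ∘ fun l => if l = j then 0 else 1) {e : E} {t : Fin N}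
    {x : (Option V × Fin d) ⊕ (E × Fin N)} (h : Represents ed a idx e t x) {T : Finset E}
    (he : e ∈ T) {χ : V → Fin 2} {o : E → Fin k} (hs : IsSolutionOn ed T χ o) :
    gadgetEval a ω χ o x = ω t (o e) := by
  rcases h with rfl | ⟨j, i, rfl, rfl⟩
  · rfl
  · rw [hidx]
    by_cases hc : a i 0 = a i 1
    · simp only [gadgetEval, gadgetPoint, hc, Sum.elim_inl, if_true, Option.elim_none,
        Function.comp_apply]
      split_ifs <;> simp [hc]
    · simp only [gadgetEval, gadgetPoint, hc, Sum.elim_inl, if_false, Option.elim_some,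
        Function.comp_apply, hs e he j]

/-- The strategy on the instance consisting of those partial maps that are consistent with all small
sets of one-in-`k` constraints. -/
def gadgetStrategy {B : Type w} {V E : Type} {k d N : ℕ} (ed : E → Fin k → V)
    (a : Fin d → Fin 2 → B) (ω : Fin N → Fin k → B) (κ M : ℕ) :
    Set ((Option V × Fin d) ⊕ (E × Fin N) →. B) :=
  {f | f.Dom.encard ≤ κ ∧ ∀ T : Finset E, T.card ≤ M → ∃ χ o, IsSolutionOn ed T χ o ∧
    ∀ x y, y ∈ f x → y = gadgetEval a ω χ o x}

-- A domain element involves at most one vertex or one edge, so `exists_isSolutionOn_of_small` with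
-- w = κ lifts consistency from small edge sets to sets of up to `s` edges. This larger range is
-- what allows maps to be extended.
open Classical in
theorem isStrategy_gadgetStrategy (L : FirstOrder.Language.{u, v}) [L.IsRelational] {B : Type w}
    [L.Structure B] {V E : Type} {k d N : ℕ} (hk : 3 ≤ k) {ed : E → Fin k → V}
    (hed : ∀ e, Function.Injective (ed e)) {a : Fin d → Fin 2 → B} {idx : Fin k → Fin d → Fin N}
    {ω : Fin N → Fin k → B}
    (hidx : ∀ j i, ω (idx j i) = a i ∘ fun l => if l = j then 0 else 1) {κ : ℕ} (hκ : 1 ≤ κ)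
    {s : ℕ} (h : Sparse ed s) (𝒱 : Finset B) (ha : ∀ i l, a i l ∈ 𝒱) (hω : ∀ t i, ω t i ∈ 𝒱)
    (hs₁ : (9 + 6 * k) * κ ≤ s) (hs₂ : 𝒱.card * ((9 + 6 * k) * κ) ≤ s) :
    letI := gadgetStructure L ed a idx ω
    IsStrategy L κ (gadgetStrategy ed a ω κ ((9 + 6 * k) * κ)) := by
  let := gadgetStructure L ed a idx ω
  refine ⟨?_, ?_, ?_, ?_⟩
  · refine ⟨fun _ => Part.none, ?_, fun T hT => ?_⟩
    · have : PFun.Dom (fun _ => Part.none : (Option V × Fin d) ⊕ (E × Fin N) →. B) = ∅ := by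
        ext; simp
      simp [this]
    · obtain ⟨χ, o, hsol, -⟩ := exists_isSolutionOn_of_small hk hed h (w := 0) (DV := ∅) (DE := ∅)
        (by simp) (by simp) (fun _ _ => True) (by simp) (fun T hT => by
          rw [mul_zero, Nat.le_zero, Finset.card_eq_zero] at hT
          subst hT
          exact ⟨fun _ => 0, fun _ => ⟨0, by omega⟩, fun e he => by simp at he, trivial⟩)
        T (hT.trans hs₁)
      exact ⟨χ, o, hsol, fun x y hy => absurd hy (Part.notMem_none y)⟩
  · rintro f ⟨-, hf⟩ r R x hx ⟨e, t, hrep, hR⟩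
    obtain ⟨χ, o, hsol, hχ⟩ := hf {e} (by rw [Finset.card_singleton]; nlinarith)
    have : ∀ l, f.fn (x l) (hx l) = ω (t l) (o e) := fun l => by
      rw [← (hrep l).gadgetEval_eq hidx (Finset.mem_singleton_self e) hsol]
      exact hχ _ _ (Part.get_mem (hx l))
    simp only [this]
    exact hR (o e)
  · rintro f ⟨hf₁, hf₂⟩ K hK
    refine ⟨(Set.encard_le_encard hK).trans hf₁, fun T hT => ?_⟩
    obtain ⟨χ, o, hsol, hχ⟩ := hf₂ T hT
    exact ⟨χ, o, hsol, fun x y hy => hχ x y ((PFun.mem_restrict hK x y).1 hy).2⟩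
  · rintro f ⟨hf₁, hf₂⟩ hlt x₀
    by_cases hx₀ : x₀ ∈ f.Dom
    · exact ⟨f, ⟨hf₁, hf₂⟩, by simp [hx₀], fun _ _ h => h⟩
    have hfin : f.Dom.Finite := Set.finite_of_encard_le_coe hf₁
    let D := hfin.toFinset
    have hD : D.card ≤ κ := by
      rw [hfin.encard_eq_coe_toFinset_card] at hf₁
      exact_mod_cast hf₁
    let DV : Finset V := D.biUnion (Sum.elim (fun p => p.1.toFinset) fun _ => ∅)
    let DE : Finset E := D.biUnion (Sum.elim (fun _ => ∅) fun p => {p.1})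
    have hDV : DV.card ≤ κ := by
      refine (Finset.card_biUnion_le_card_mul _ _ 1 ?_).trans (by omega)
      rintro (⟨_ | v, i⟩ | p) - <;> simp
    have hDE : DE.card ≤ κ := by
      refine (Finset.card_biUnion_le_card_mul _ _ 1 ?_).trans (by omega)
      rintro (p | p) - <;> simp
    have hbig := exists_isSolutionOn_of_small hk hed h hDV hDE
      (fun χ o => ∀ x y, y ∈ f x → y = gadgetEval a ω χ o x) (by
        intro χ χ' o o' hχ ho hf x y hy
        rw [hf x y hy]
        have hx : x ∈ D := by
          rw [Set.Finite.mem_toFinset]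
          exact (PFun.mem_dom f x).2 ⟨y, hy⟩
        rcases x with ⟨_ | v, i⟩ | ⟨e, t⟩
        · rfl
        · simp only [gadgetEval, Sum.elim_inl, Option.elim_some]
          rw [hχ v (Finset.mem_biUnion.2 ⟨_, hx, by simp⟩)]
        · simp only [gadgetEval, Sum.elim_inr]
          rw [ho e (Finset.mem_biUnion.2 ⟨_, hx, by simp⟩)]) hf₂
    let g : B → ((Option V × Fin d) ⊕ (E × Fin N) →. B) := fun b x =>
      if x = x₀ then Part.some b else f x
    have hgdom : ∀ b, (g b).Dom = f.Dom ∪ {x₀} := by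
      intro b
      ext x
      by_cases hx : x = x₀ <;> simp [g, hx, PFun.mem_dom, Part.dom_iff_mem]
    have hgcard : ∀ b, (g b).Dom.encard ≤ κ := by
      intro b
      rw [hgdom]
      refine (Set.encard_union_le _ _).trans ?_
      rw [Set.encard_singleton]
      exact Order.add_one_le_of_lt hlt
    suffices H : ∃ b, g b ∈ gadgetStrategy ed a ω κ ((9 + 6 * k) * κ) by
      obtain ⟨b, hb⟩ := H
      refine ⟨g b, hb, hgdom b, fun x y hy => ?_⟩
      have : x ≠ x₀ := by
        rintro rfl
        exact hx₀ ((PFun.mem_dom f x).2 ⟨y, hy⟩)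
      simpa [g, this] using hy
    by_contra! hcon
    have hT : ∀ b, ∃ T : Finset E, T.card ≤ (9 + 6 * k) * κ ∧ ∀ χ o, IsSolutionOn ed T χ o →
        ¬ ∀ x y, y ∈ g b x → y = gadgetEval a ω χ o x := by
      intro b
      by_contra! hT
      exact hcon b ⟨hgcard b, hT⟩
    choose T hTcard hT using hT
    -- If every value at `x₀` were refuted by a small edge set, the union of these sets over the
    -- finite set `𝒱` would still have at most `s` edges. A solution on the union supplies an
    -- unrefuted value in `𝒱`.
    obtain ⟨χ, o, hsol, hχ⟩ := hbig (𝒱.biUnion T)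
      ((Finset.card_biUnion_le_card_mul 𝒱 T _ fun b _ => hTcard b).trans hs₂)
    have hmem : gadgetEval a ω χ o x₀ ∈ 𝒱 := by
      rcases x₀ with p | p
      · exact ha _ _
      · exact hω _ _
    refine hT (gadgetEval a ω χ o x₀) χ o
      (fun e he => hsol e (Finset.mem_biUnion.2 ⟨_, hmem, he⟩)) fun x y hy => ?_
    by_cases hx : x = x₀
    · simp only [g, hx, if_true, Part.mem_some_iff] at hy
      rw [hy, hx]
    · simp only [g, hx, if_false] at hy
      exact hχ x y hy

/-- This makes restriction of a homomorphism to one copy well defined. If rows for different j, j'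
coincide, a third position (k ≥ 3) gives a_i(1) = a_{i'}(1), and positions j and j' then force both
evaluations to be constant and equal; constant evaluations have a point independent of the vertex.
-/
theorem gadgetPoint_eq {B : Type w} {V E : Type} {k d N : ℕ} (hk : 3 ≤ k) (ed : E → Fin k → V)
    {a : Fin d → Fin 2 → B} (ha : Function.Injective a) {idx : Fin k → Fin d → Fin N}
    {ω : Fin N → Fin k → B}
    (hidx : ∀ j i, ω (idx j i) = a i ∘ fun l => if l = j then 0 else 1) (e : E) {j j' : Fin k}
    {i i' : Fin d} (h : idx j i = idx j' i') :
    gadgetPoint a (ed e j) i = gadgetPoint a (ed e j') i' := by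
  have heq : ∀ l, a i (if l = j then 0 else 1) = a i' (if l = j' then 0 else 1) :=
    congrFun ((hidx j i).symm.trans ((congrArg ω h).trans (hidx j' i')))
  obtain ⟨l, hl⟩ : ∃ l, l ∉ ({j, j'} : Finset (Fin k)) := by
    by_contra! hall
    have := Finset.card_le_card (fun l _ => hall l : Finset.univ ⊆ ({j, j'} : Finset (Fin k)))
    have h₂ := Finset.card_le_two (a := j) (b := j')
    rw [Finset.card_fin] at this
    omega
  simp only [Finset.mem_insert, Finset.mem_singleton, not_or] at hl
  have h₁ : a i 1 = a i' 1 := by simpa [hl.1, hl.2] using heq l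
  by_cases hjj : j = j'
  · subst hjj
    have h₀ : a i 0 = a i' 0 := by simpa using heq j
    have : i = i' := ha (by
      funext y
      fin_cases y
      exacts [h₀, h₁])
    rw [this]
  · have h₂ : a i 0 = a i' 1 := by simpa [hjj] using heq j
    have h₃ : a i 1 = a i' 0 := by simpa [Ne.symm hjj] using heq j'
    have : i = i' := ha (by
      funext y
      fin_cases y
      · exact h₂.trans (h₁.symm.trans h₃)
      · exact h₁)
    subst this
    simp [gadgetPoint, h₂]

theorem satisfiesModulo_wnu {L : FirstOrder.Language.{u, v}} [L.IsRelational]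
    {B : Type w} [Countable B] [L.Structure B]
    {G : Subgroup (Equiv.Perm B)} (hG : G ≤ autGroup L B) (hGo : IsOligomorphic G)
    (h : BoundedWidth L B) {k : ℕ} (hk : 3 ≤ k) :
    SatisfiesModulo L B (groupClosure G) (wnu k) := by
  classical
  by_contra hcon
  have : NeZero k := ⟨by omega⟩
  obtain ⟨d, N, a, ω, idx, ha, hidx, hη⟩ := exists_finite_obstruction hG hGo
    (fun i j : Fin k => if j = i then (0 : Fin 2) else 1) (fun j y => by
      have : Nontrivial (Fin k) := Fin.nontrivial_iff_two_le.2 (by omega)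
      obtain ⟨l, hl⟩ := exists_ne j
      fin_cases y
      · exact ⟨j, by simp⟩
      · exact ⟨l, by simp [hl]⟩) hcon
  obtain ⟨r, hr, c, hc⟩ := exists_orbit_coloring hGo d 1
  obtain ⟨κ, hκ, hwidth⟩ := h
  let 𝒱 : Finset B := Finset.univ.image (fun p : Fin d × Fin 2 => a p.1 p.2) ∪
    Finset.univ.image fun p : Fin N × Fin k => ω p.1 p.2
  obtain ⟨V, E, _, _, ed, hed, hsparse, hcol⟩ := exists_sparse_not_colorable hr
    ((9 + 6 * k) * κ + 𝒱.card * ((9 + 6 * k) * κ)) (Fin k)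
  let := gadgetStructure L ed a idx ω
  obtain ⟨F⟩ := hwidth _ ⟨_, isStrategy_gadgetStrategy L hk hed hidx hκ hsparse 𝒱
    (fun i l => Finset.mem_union_left _
      (Finset.mem_image_of_mem (fun p : Fin d × Fin 2 => a p.1 p.2) (Finset.mem_univ (i, l))))
    (fun t i => Finset.mem_union_right _
      (Finset.mem_image_of_mem (fun p : Fin N × Fin k => ω p.1 p.2) (Finset.mem_univ (t, i))))
    (Nat.le_add_right _ _) (Nat.le_add_left _ _)⟩
  -- On a monochromatic edge all rows are sent into one orbit, so `F` on the copy of that edge is a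
  -- partial polymorphism contradicting the obstruction.
  obtain ⟨e, he⟩ := hcol fun v => c fun i => F (.inl (gadgetPoint a v i))
  have hrep : ∀ t, ∃ x, Represents ed a idx e t x ∧
      ∀ j i, idx j i = t → x = .inl (gadgetPoint a (ed e j) i) := by
    intro t
    by_cases hex : ∃ j i, idx j i = t
    · obtain ⟨j, i, rfl⟩ := hex
      refine ⟨_, .inr ⟨j, i, rfl, rfl⟩, fun j' i' hji => ?_⟩
      rw [gadgetPoint_eq hk ed ha hidx e hji]
    · exact ⟨_, .inl rfl, fun j i hji => absurd ⟨j, i, hji⟩ hex⟩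
  choose x hx hxeq using hrep
  refine hη (fun t => F (x t)) (fun R t hR => F.map_rel R _ ⟨e, t, fun l => hx _, hR⟩)
    fun j j' => ?_
  simp only [hxeq _ _ _ rfl]
  exact hc _ _ (he j j')

end PCSP

theorem mainTheorem6 (L : FirstOrder.Language.{u, v}) [L.IsRelational] [Finite L.Symbols]
    (B : Type w) [Countable B] [L.Structure B]
    (G : Subgroup (Equiv.Perm B)) (hG : G ≤ PCSP.autGroup L B) (hGo : PCSP.IsOligomorphic G) :
    ((∀ r : ℕ, 2 ≤ r → ¬ PCSP.PPConstructs L B (PCSP.structH 2) (PCSP.structH r)) →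
      PCSP.SatisfiesModulo L B (PCSP.groupClosure G) PCSP.olsak) ∧
    ((∀ r : ℕ, 3 ≤ r → ¬ PCSP.PPConstructs L B (PCSP.structK 3) (PCSP.structK r)) →
      PCSP.SatisfiesModulo L B (PCSP.groupClosure G) PCSP.siggers6) ∧
    ((∀ r : ℕ, 3 ≤ r → ¬ PCSP.PPConstructs L B PCSP.structD (PCSP.structK r)) →
      PCSP.SatisfiesModulo L B (PCSP.groupClosure G) PCSP.siggers4) ∧
    (PCSP.BoundedWidth L B →
      ∀ k : ℕ, 3 ≤ k → PCSP.SatisfiesModulo L B (PCSP.groupClosure G) (PCSP.wnu k)) :=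
  ⟨PCSP.satisfiesModulo_olsak hG hGo, PCSP.satisfiesModulo_siggers6 hG hGo,
    PCSP.satisfiesModulo_siggers4 hG hGo, fun h _ hk => PCSP.satisfiesModulo_wnu hG hGo h hk⟩
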